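/- Let $X_0, X_1$ be connected finite CW complexes whose topologies are induced by complete length metrics $d_0, d_1$ (the distance of two points is the infimum of the lengths of the paths joining them). Let $\pi,\phi\colon X_1 \rightrightarrows X_0$ be a virtual endomorphism, i.e. $\pi,\phi$ are continuous and $\pi$ is a covering map of finite degree $\deg\pi$, and suppose that $\pi$ is a local isometry (so that $d_1$ is the length metric induced by the covering $\pi$). Suppose that $(\pi,\phi)$ is $\lambda$-backward-contracting for some $0<\lambda<1$, i.e. $d_0(\phi(a),\phi(b))\le \lambda\, d_1(a,b)$ for all $a,b\in X_1$, and recurrent, i.e. $\phi_*\colon \pi_1(X_1)\to\pi_1(X_0)$ is surjective. Let $$\mathcal J=\{(x_1,x_2,\ldots)\in X_1^{\mathbb N} : \pi(x_i)=\phi(x_{i+1}) \text{ for all } i\ge 1\}$$ be its limit space, with the subspace topology of the product topology, and let $f\colon\mathcal J\to\mathcal J$, $f(x_1,x_2,\ldots)=(x_2,x_3,\ldots)$, be the shift. Then: 1. $\mathcal J$ is connected and locally connected. 2. $f$ is a covering map of degree $\deg\pi$ and is positively expansive: $\mathcal J$ is metrizable, $f$ is a continuous surjection, and for every compatible metric $d$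 on $\mathcal J$ there is $e>0$ such that for all $x\ne y$ in $\mathcal J$ there is $n\ge 0$ with $d(f^n(x),f^n(y))>e$. 3. $f$ is topologically coarse expanding conformal (cxc): $\mathcal J$ is compact, connected and locally connected, $f$ is a covering map, and there is a finite cover $\mathcal U_0$ of $\mathcal J$ by connected open sets such that, with $\mathcal U_{n+1}$ defined inductively as the set of connected components of the sets $f^{-1}(U)$, $U\in\mathcal U_n$, the following hold. - [Expansion] For every compatible metric on $\mathcal J$, the supremum of the diameters of the elements of $\mathcal U_n$ tends to $0$ as $n\to\infty$. - [Degree] There is $p\in\mathbb N$ such that for all $n,k\ge 0$, all $U\in\mathcal U_n$ and all $\widetilde U\in\mathcal U_{n+k}$ with $f^k(\widetilde U)\subset U$, the fibers of $f^k\colon\widetilde U\to U$ have at most $p$ points. - [Irreducibility] For every nonempty open $W\subset\mathcal J$ there is $N$ with $f^N(W)=\mathcal J$. -/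

import Mathlib

open Set Filter Topology

/-- The metric of `X` is a length metric: the distance between two points is the infimum of the
lengths of the paths joining them. -/
def IsLengthMetric (X : Type*) [MetricSpace X] : Prop :=
  ∀ x y : X, edist x y = ⨅ γ : Path x y, eVariationOn (γ : unitInterval → X) univ

/-- Every point has a neighbourhood on which `p` preserves distances. -/
def IsLocalIsometry {X Y : Type*} [MetricSpace X] [MetricSpace Y] (p : X → Y) : Prop :=
  ∀ x : X, ∃ U ∈ 𝓝 x, ∀ a ∈ U, ∀ b ∈ U, dist (p a) (p b) = dist a b

/-- `p` is a covering map all of whose fibers have exactly `d` points. A pair of continuous maps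
`π, φ : X₁ ⇉ X₀` is a virtual endomorphism if `π` is a covering map of some finite degree. -/
def IsCoveringMapOfDegree {X Y : Type*} [TopologicalSpace X] [TopologicalSpace Y]
    (p : X → Y) (d : ℕ) : Prop :=
  IsCoveringMap p ∧ ∀ y : Y, (p ⁻¹' {y}).encard = d

/-- The virtual endomorphism `(π, φ)` is `c`-backward-contracting (a condition on `φ` alone). -/
def IsBackwardContracting {X₁ X₀ : Type*} [MetricSpace X₁] [MetricSpace X₀]
    (c : ℝ) (φ : X₁ → X₀) : Prop :=
  0 < c ∧ c < 1 ∧ ∀ a b : X₁, dist (φ a) (φ b) ≤ c * dist a b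

/-- The virtual endomorphism `(π, φ)` is recurrent (a condition on the spaces and `φ`): both spaces
are connected and `φ` is surjective on fundamental groups. -/
structure IsRecurrent {X₁ X₀ : Type*} [TopologicalSpace X₁] [TopologicalSpace X₀]
    (φ : C(X₁, X₀)) : Prop where
  connected_source : ConnectedSpace X₁
  connected_target : ConnectedSpace X₀
  surjective_map : ∀ x : X₁, Function.Surjective (FundamentalGroup.map φ x)

/-- The limit space of `π, φ : X₁ ⇉ X₀`: the one-sided infinite orbits, as a subspace of the
product space `ℕ → X₁`. -/
def LimitSpace {X₁ X₀ : Type*} (π φ : X₁ → X₀) : Type _ :=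
  {x : ℕ → X₁ // ∀ i, π (x i) = φ (x (i + 1))}

instance LimitSpace.instTopologicalSpace {X₁ X₀ : Type*} [TopologicalSpace X₁] (π φ : X₁ → X₀) :
    TopologicalSpace (LimitSpace π φ) :=
  inferInstanceAs (TopologicalSpace {x : ℕ → X₁ // ∀ i, π (x i) = φ (x (i + 1))})

/-- The map `(x₁, x₂, x₃, …) ↦ (x₂, x₃, …)` of the limit space. -/
def LimitSpace.shift {X₁ X₀ : Type*} (π φ : X₁ → X₀) : LimitSpace π φ → LimitSpace π φ :=
  fun x => ⟨fun i => x.1 (i + 1), fun i => x.2 (i + 1)⟩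

/-- The metric `m` induces the topology `t`. -/
def IsCompatibleMetric {X : Type*} [t : TopologicalSpace X] (m : MetricSpace X) : Prop :=
  m.toPseudoMetricSpace.toUniformSpace.toTopologicalSpace = t

/-- Two distinct points are at some time separated by more than a uniform constant. -/
def SeparatesOrbits {X : Type*} (m : MetricSpace X) (f : X → X) : Prop :=
  ∃ e > 0, ∀ x y : X, x ≠ y → ∃ n : ℕ, e < dist (f^[n] x) (f^[n] y)

/-- A positively expansive continuous surjection of a metrizable space. The separation condition
is required for every compatible metric; on a compact space it does not depend on the metric. -/
structure IsPositivelyExpansive {X : Type*} [TopologicalSpace X] (f : X → X) : Prop where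
  metrizable : TopologicalSpace.MetrizableSpace X
  continuous : Continuous f
  surjective : Function.Surjective f
  separates : ∀ m : MetricSpace X, IsCompatibleMetric m → SeparatesOrbits m f

/-- The connected components of the preimages `f ⁻¹(U)`, for `U` in the family `𝒰`. -/
def pullbackFamily {X : Type*} [TopologicalSpace X] (f : X → X) (𝒰 : Set (Set X)) : Set (Set X) :=
  {V | ∃ U ∈ 𝒰, ∃ x ∈ f ⁻¹' U, V = connectedComponentIn (f ⁻¹' U) x}

/-- The sequence of coverings `𝒰₀, 𝒰₁, 𝒰₂, …` generated by `𝒰₀`. -/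
def iteratedPullback {X : Type*} [TopologicalSpace X] (f : X → X) (𝒰₀ : Set (Set X)) (n : ℕ) :
    Set (Set X) :=
  (pullbackFamily f)^[n] 𝒰₀

/-- The supremum of the diameters of the members of a family of sets. -/
noncomputable def mesh {X : Type*} (m : MetricSpace X) (𝒰 : Set (Set X)) : ENNReal :=
  ⨆ U ∈ 𝒰, Metric.ediam U

/-- Axiom [Expansion]; on a compact space the condition does not depend on the metric. -/
def AxiomExpansion {X : Type*} [TopologicalSpace X] (f : X → X) (𝒰₀ : Set (Set X)) : Prop :=
  TopologicalSpace.MetrizableSpace X ∧ ∀ m : MetricSpace X, IsCompatibleMetric m →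
    Tendsto (fun n => mesh m (iteratedPullback f 𝒰₀ n)) atTop (𝓝 0)

/-- Axiom [Degree]: one bound for the cardinalities of the fibers of all the restrictions
`f^k : V → U` with `U ∈ 𝒰ₙ`, `V ∈ 𝒰ₙ₊ₖ`, where `n` and `k` are arbitrary. -/
def AxiomDegree {X : Type*} [TopologicalSpace X] (f : X → X) (𝒰₀ : Set (Set X)) : Prop :=
  ∃ p : ℕ, ∀ n k : ℕ, ∀ U ∈ iteratedPullback f 𝒰₀ n, ∀ V ∈ iteratedPullback f 𝒰₀ (n + k),
    MapsTo f^[k] V U → ∀ y ∈ U, (V ∩ f^[k] ⁻¹' {y}).encard ≤ p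

/-- Axiom [Irreducibility]. -/
def AxiomIrreducibility {X : Type*} [TopologicalSpace X] (f : X → X) : Prop :=
  ∀ W : Set X, IsOpen W → W.Nonempty → ∃ N : ℕ, f^[N] '' W = univ

/-- A self-covering of a compact, connected, locally connected space is topologically coarse
expanding conformal. -/
structure IsTopologicallyCXC {X : Type*} [TopologicalSpace X] (f : X → X) : Prop where
  compact : CompactSpace X
  connected : ConnectedSpace X
  locallyConnected : LocallyConnectedSpace X
  isCoveringMap : IsCoveringMap f
  exists_cover : ∃ 𝒰₀ : Set (Set X), 𝒰₀.Finite ∧ (∀ U ∈ 𝒰₀, IsOpen U ∧ IsConnected U) ∧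
    ⋃₀ 𝒰₀ = univ ∧ AxiomExpansion f 𝒰₀ ∧ AxiomDegree f 𝒰₀ ∧ AxiomIrreducibility f

/-!
The covering `π` is isometric, with isometric local sections, at a uniform scale `ρ`, and `φ`
contracts by the factor `c`. Hence two orbits `x`, `y` that stay `ρ`-close up to time `n` satisfy
`d(xᵢ, yᵢ) ≤ c ^ (n - i) * d(xₙ, yₙ)`, and an orbit can be made to end at any point near `xₙ`, with
an error that decays geometrically backwards. This makes the shift an expansive covering map; by
connectedness, the pullbacks of a small cover shrink and are mapped injectively by the iterates of
the shift.

Connectedness needs recurrence. Let a chain of `N` orbits of length `n` be given whose two ends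
extend to time `n + 1` by `a` and `b`. Fill in the last terms of the chain to a path `q`. As `φ` is
surjective on `π₁`, some path `ω` from `a` to `b` has `φ ∘ ω` homotopic to `π ∘ q`, and the
homotopy lifts through `π`, so that lifting `ω` backwards leads from the first orbit to the last
one. Thus the ends are joined by a chain of `M` orbits of length `n + 1`, where by compactness `M`
depends on `N` only. Iterating, two points whose initial segments are joined by a chain of length
`N` are joined by arbitrarily fine chains of points, and the distances sum to a geometric series.
-/

open scoped unitInterval

section Compactness

theorem exists_forall_of_isCompact {X : Type*} [TopologicalSpace X] {K : Set X} (hK : IsCompact K)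
    {P : ℕ → X → Prop} (hmono : ∀ ⦃m n⦄, m ≤ n → ∀ x, P m x → P n x)
    (h : ∀ x ∈ K, ∃ n, ∀ᶠ y in 𝓝 x, P n y) : ∃ n, ∀ x ∈ K, P n x := by
  obtain ⟨n, hn⟩ := hK.elim_directed_cover (fun n => interior {x | P n x})
    (fun _ => isOpen_interior)
    (fun x hx => mem_iUnion.2 ((h x hx).imp fun _ => mem_interior_iff_mem_nhds.2))
    (Monotone.directed_le fun _ _ hmn => interior_mono fun x => hmono hmn x)
  exact ⟨n, fun x hx => interior_subset (hn hx)⟩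

theorem exists_pos_forall_of_isCompact {X : Type*} [TopologicalSpace X] {K : Set X}
    (hK : IsCompact K) {P : ℝ → X → Prop} (hanti : ∀ ⦃s t⦄, s ≤ t → ∀ x, P t x → P s x)
    (h : ∀ x ∈ K, ∃ s > 0, ∀ᶠ y in 𝓝 x, P s y) : ∃ s > 0, ∀ x ∈ K, P s x := by
  obtain ⟨n, hn⟩ := exists_forall_of_isCompact hK (P := fun n x => P (1 / ((n : ℝ) + 1)) x)
    (fun m n hmn => hanti (Nat.one_div_le_one_div hmn)) fun x hx => by
      obtain ⟨s, hs, hy⟩ := h x hx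
      obtain ⟨n, hn⟩ := exists_nat_one_div_lt hs
      exact ⟨n, hy.mono fun y => hanti hn.le y⟩
  exact ⟨_, Nat.one_div_pos_of_nat, hn⟩

theorem compactSpace_of_finite_cwComplex {X : Type*} [TopologicalSpace X]
    [CWComplex (univ : Set X)] [CWComplex.Finite (univ : Set X)] : CompactSpace X := by
  obtain ⟨n, hn⟩ := eventually_atTop.1
    (RelCWComplex.FiniteDimensional.eventually_isEmpty_cell (C := (univ : Set X)) (D := ∅))
  have hfin : ∀ m, Finite (RelCWComplex.cell (univ : Set X) m) :=
    fun m => RelCWComplex.FiniteType.finite_cell (C := (univ : Set X)) (D := ∅) m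
  have hcover : univ ⊆ ⋃ m ∈ Finset.range n, ⋃ j : RelCWComplex.cell (univ : Set X) m,
      RelCWComplex.closedCell m j := by
    refine (CWComplex.union (C := (univ : Set X))).symm.subset.trans
      (iUnion_subset fun m => iUnion_subset fun j => ?_)
    have hm : m < n := by
      by_contra! hm
      exact (hn m hm).false j
    exact subset_biUnion_of_mem (u := fun m => ⋃ j : RelCWComplex.cell (univ : Set X) m,
      RelCWComplex.closedCell m j) (Finset.mem_range.2 hm) |>.trans' (subset_iUnion _ j)
  refine ⟨.of_isClosed_subset ?_ isClosed_univ hcover⟩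
  exact (Finset.range n).isCompact_biUnion fun m _ =>
    isCompact_iUnion fun j => CWComplex.isCompact_closedCell

end Compactness

/-- `x` and `y` are joined by a chain of exactly `n` steps of the relation `R`; a counted version of
`Relation.ReflTransGen`, for chains whose lengths have to be bounded uniformly. -/
def Steps {α : Type*} (R : α → α → Prop) (n : ℕ) (x y : α) : Prop :=
  ∃ z : ℕ → α, z 0 = x ∧ z n = y ∧ ∀ j < n, R (z j) (z (j + 1))

namespace Steps

variable {α : Type*} {R : α → α → Prop} {m n : ℕ} {x y z : α}

theorem zero (x : α) : Steps R 0 x x := ⟨fun _ => x, rfl, rfl, by simp⟩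

theorem single (h : R x y) : Steps R 1 x y :=
  ⟨fun j => if j = 0 then x else y, by simp, by simp, fun j hj => by
    obtain rfl : j = 0 := by omega
    simpa using h⟩

theorem trans (h₁ : Steps R m x y) (h₂ : Steps R n y z) : Steps R (m + n) x z := by
  obtain ⟨u, hu0, hum, hu⟩ := h₁
  obtain ⟨v, hv0, hvn, hv⟩ := h₂
  have hjoin : ∀ j, m ≤ j → (if j ≤ m then u j else v (j - m)) = v (j - m) := fun j hj => by
    split_ifs with h
    · obtain rfl : j = m := le_antisymm h hj
      simp [hum, hv0]
    · rfl
  refine ⟨fun j => if j ≤ m then u j else v (j - m), by simpa using hu0, ?_, fun j hj => ?_⟩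
  · simpa [hvn] using hjoin (m + n) (by omega)
  · rcases lt_or_ge j m with h | h
    · simpa [h.le, Nat.succ_le_of_lt h] using hu j h
    · beta_reduce
      rw [hjoin j h, hjoin (j + 1) (by omega), Nat.sub_add_comm h]
      exact hv (j - m) (by omega)

theorem symm (hR : ∀ x y, R x y → R y x) (h : Steps R n x y) : Steps R n y x := by
  obtain ⟨u, hu0, hun, hu⟩ := h
  refine ⟨fun j => u (n - j), by simpa using hun, by simpa using hu0, fun j hj => ?_⟩
  have := hR _ _ (hu (n - (j + 1)) (by omega))
  rwa [show n - (j + 1) + 1 = n - j by omega] at this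

theorem mono (hy : R y y) (hmn : m ≤ n) (h : Steps R m x y) : Steps R n x y := by
  have : Steps R (n - m) y y := ⟨fun _ => y, rfl, rfl, fun _ _ => hy⟩
  simpa [hmn] using h.trans this

end Steps

section Connectedness

theorem forall_le_of_isPreconnected_of_gap {T : Type*} [TopologicalSpace T] {S : Set T}
    (hS : IsPreconnected S) {g : T → ℝ} (hg : ContinuousOn g S) {r ρ : ℝ} (hr : r < ρ)
    (hgap : ∀ t ∈ S, g t < ρ → g t ≤ r) {s : T} (hs : s ∈ S) (hgs : g s ≤ r) :
    ∀ t ∈ S, g t ≤ r := by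
  intro t ht
  by_contra! hlt
  obtain ⟨q, hrq, hqm⟩ := exists_between (lt_min hlt hr)
  obtain ⟨u, hu, rfl⟩ := hS.intermediate_value hs ht hg
    ⟨hgs.trans hrq.le, (hqm.trans_le (min_le_left _ _)).le⟩
  exact (hgap u hu (hqm.trans_le (min_le_right _ _))).not_gt hrq

theorem exists_forall_steps_dist_le {X : Type*} [MetricSpace X] [CompactSpace X]
    [PreconnectedSpace X] {r : ℝ} (hr : 0 < r) :
    ∃ N, ∀ x y : X, Steps (fun a b => dist a b ≤ r) N x y := by
  have hrefl : ∀ x : X, dist x x ≤ r := fun x => by simpa using hr.le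
  have hnear : ∀ x : X, ∀ᶠ y in 𝓝 x, dist x y ≤ r := fun x => by
    filter_upwards [Metric.closedBall_mem_nhds x hr] with y hy
    rwa [dist_comm]
  have hpair : ∀ x y : X, ∃ N, Steps (fun a b => dist a b ≤ r) N x y := by
    intro x y
    refine isPreconnected_univ.induction₂
      (fun x y => ∃ N, Steps (fun a b => dist a b ≤ r) N x y) ?_ ?_ ?_ (mem_univ x) (mem_univ y)
    · intro x _
      filter_upwards [mem_nhdsWithin_of_mem_nhds (hnear x)] with y hy using ⟨1, .single hy⟩
    · rintro x y z - - - ⟨m, hm⟩ ⟨n, hn⟩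
      exact ⟨m + n, hm.trans hn⟩
    · rintro x y - - ⟨m, hm⟩
      exact ⟨m, hm.symm fun a b h => by rwa [dist_comm]⟩
  obtain ⟨N, hN⟩ := exists_forall_of_isCompact (isCompact_univ (X := X × X))
    (P := fun N p => Steps (fun a b => dist a b ≤ r) N p.1 p.2)
    (fun m n hmn p => .mono (hrefl _) hmn) (by
      rintro ⟨x, y⟩ -
      obtain ⟨N, hN⟩ := hpair x y
      refine ⟨1 + N + 1, ?_⟩
      filter_upwards [prod_mem_nhds (hnear x) (hnear y)] with ⟨a, b⟩ ⟨ha, hb⟩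
      exact (Steps.single (by rwa [dist_comm])).trans hN |>.trans (.single hb))
  exact ⟨N, fun x y => hN (x, y) (mem_univ _)⟩

theorem exists_path_forall_dist_le {X : Type*} [MetricSpace X] [CompactSpace X]
    [LocallyPathConnectedSpace X] {s : ℝ} (hs : 0 < s) :
    ∃ r > 0, ∀ x y : X, dist x y ≤ r → ∃ γ : Path x y, ∀ t, dist x (γ t) ≤ s := by
  obtain ⟨r, hr, h⟩ := exists_pos_forall_of_isCompact (isCompact_univ (X := X))
    (P := fun r x => ∀ y, dist x y ≤ r → ∃ γ : Path x y, ∀ t, dist x (γ t) ≤ s)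
    (fun r r' hr x h y hy => h y (hy.trans hr)) fun x _ => by
      obtain ⟨U, ⟨hU, hUc⟩, hUs⟩ := (path_connected_basis x).mem_iff.1
        (Metric.ball_mem_nhds x (half_pos hs))
      obtain ⟨r, hr, hrU⟩ := Metric.mem_nhds_iff.1 hU
      refine ⟨r / 3, by positivity, ?_⟩
      filter_upwards [Metric.ball_mem_nhds x (show 0 < r / 3 by positivity)] with a ha b hab
      rw [Metric.mem_ball] at ha
      have haU : a ∈ U := hrU (by rw [Metric.mem_ball]; linarith)
      have hbU : b ∈ U := hrU (by
        rw [Metric.mem_ball]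
        linarith [dist_triangle_left b x a])
      obtain ⟨γ, hγ⟩ := hUc.joinedIn a haU b hbU
      refine ⟨γ, fun t => ?_⟩
      have hat := Metric.mem_ball.1 (hUs haU)
      have hbt := Metric.mem_ball.1 (hUs (hγ t))
      linarith [dist_triangle_right a (γ t) x]
  exact ⟨r, hr, fun x => h x (mem_univ x)⟩

theorem mem_connectedComponentIn_of_chains {X : Type*} [MetricSpace X] {Q : Set X}
    (hQ : IsCompact Q) {x y : X} (hx : x ∈ Q)
    (h : ∀ δ > 0, Relation.ReflTransGen (fun a b => b ∈ Q ∧ dist a b < δ) x y) :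
    y ∈ connectedComponentIn Q x := by
  have : CompactSpace Q := isCompact_iff_compactSpace.1 hQ
  have hclopen : ∀ Z : Set Q, IsClopen Z → ⟨x, hx⟩ ∈ Z → ∃ hy : y ∈ Q, ⟨y, hy⟩ ∈ Z := by
    intro Z hZ hxZ
    obtain ⟨δ, hδ, hZδ⟩ := hZ.isClosed.isCompact.exists_thickening_subset_open hZ.isOpen .rfl
    have hxy := h δ hδ
    clear h
    induction hxy with
    | refl => exact ⟨hx, hxZ⟩
    | tail _ hab ih =>
      obtain ⟨ha, haZ⟩ := ih
      exact ⟨hab.1, hZδ (Metric.mem_thickening_iff.2 ⟨⟨_, ha⟩, haZ, by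
        rw [dist_comm]; exact hab.2⟩)⟩
  obtain ⟨hy, -⟩ := hclopen univ isClopen_univ (mem_univ _)
  rw [connectedComponentIn_eq_image hx]
  refine ⟨⟨y, hy⟩, ?_, rfl⟩
  rw [connectedComponent_eq_iInter_isClopen, mem_iInter]
  rintro ⟨Z, hZ, hxZ⟩
  exact (hclopen Z hZ hxZ).2

end Connectedness

theorem exists_path_map_homotopic {X Y : Type*} [TopologicalSpace X] [TopologicalSpace Y]
    [PathConnectedSpace X] {φ : C(X, Y)} {a b : X}
    (hφ : Function.Surjective (FundamentalGroup.map φ a)) (q : Path (φ a) (φ b)) :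
    ∃ ω : Path a b, (ω.map φ.continuous).Homotopic q := by
  let h : Path a b := PathConnectedSpace.somePath a b
  obtain ⟨l, hl⟩ := hφ (Path.Homotopic.Quotient.mk (q.trans (h.map φ.continuous).symm))
  obtain ⟨l, rfl⟩ := Path.Homotopic.Quotient.mk_surjective l
  have hl' : (l.map φ.continuous).Homotopic (q.trans (h.map φ.continuous).symm) :=
    Path.Homotopic.Quotient.exact hl
  refine ⟨l.trans h, ?_⟩
  rw [Path.map_trans]
  exact (hl'.hcomp (.refl _)).trans <| (Path.Homotopic.trans_assoc _ _ _).trans <|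
    ((Path.Homotopic.refl q).hcomp (Path.Homotopic.symm_trans _)).trans
      (Path.Homotopic.trans_refl q)

theorem IsLengthMetric.exists_path {X : Type*} [MetricSpace X] (h : IsLengthMetric X) {x y : X}
    {R : ℝ} (hR : dist x y < R) : ∃ γ : Path x y, ∀ t, dist x (γ t) < R := by
  have hlt : edist x y < ENNReal.ofReal R := by
    rwa [edist_dist, ENNReal.ofReal_lt_ofReal_iff (dist_nonneg.trans_lt hR)]
  rw [h x y, iInf_lt_iff] at hlt
  obtain ⟨γ, hγ⟩ := hlt
  refine ⟨γ, fun t => ?_⟩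
  have hle := eVariationOn.edist_le (γ : unitInterval → X) (mem_univ 0) (mem_univ t)
  rw [γ.source] at hle
  rw [← ENNReal.ofReal_lt_ofReal_iff (dist_nonneg.trans_lt hR), ← edist_dist]
  exact hle.trans_lt hγ

theorem IsLengthMetric.locallyPathConnectedSpace {X : Type*} [MetricSpace X]
    (h : IsLengthMetric X) : LocallyPathConnectedSpace X := by
  refine .of_bases (fun x => Metric.nhds_basis_ball) fun x R hR =>
    ⟨x, Metric.mem_ball_self hR, fun {y} hy => ?_⟩
  obtain ⟨γ, hγ⟩ := h.exists_path (Metric.mem_ball'.1 hy)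
  exact ⟨γ, fun t => Metric.mem_ball'.2 (hγ t)⟩

/-- At scale `ρ`, the map `p` is isometric and has isometric local sections: the form in which a
local isometry that is a covering of a compact space is used. -/
structure HasIsometricSheets {X Y : Type*} [MetricSpace X] [MetricSpace Y] (p : X → Y) (ρ : ℝ) :
    Prop where
  pos : 0 < ρ
  isometric : ∀ a b, dist a b < ρ → dist (p a) (p b) = dist a b
  exists_lift : ∀ a z, dist (p a) z < ρ → ∃ b, p b = z ∧ dist a b = dist (p a) z

namespace IsLocalIsometry

variable {X Y : Type*} [MetricSpace X] [MetricSpace Y] [CompactSpace X] {p : X → Y}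

theorem exists_pos_forall_dist_eq (hp : IsLocalIsometry p) :
    ∃ δ > 0, ∀ a b, dist a b < δ → dist (p a) (p b) = dist a b := by
  obtain ⟨δ, hδ, h⟩ := exists_pos_forall_of_isCompact (isCompact_univ (X := X))
    (P := fun δ a => ∀ b, dist a b < δ → dist (p a) (p b) = dist a b)
    (fun s t hst a h b hb => h b (hb.trans_le hst)) fun x _ => by
      obtain ⟨U, hU, hUp⟩ := hp x
      obtain ⟨s, hs, hsU⟩ := Metric.mem_nhds_iff.1 hU
      refine ⟨s / 2, half_pos hs, ?_⟩
      filter_upwards [hU, Metric.ball_mem_nhds x (half_pos hs)] with a haU ha b hab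
      refine hUp a haU b (hsU ?_)
      rw [Metric.mem_ball] at ha ⊢
      linarith [dist_triangle_left b x a]
  exact ⟨δ, hδ, fun a => h a (mem_univ a)⟩

theorem exists_hasIsometricSheets (hp : IsLocalIsometry p) (hc : Continuous p)
    (ho : IsOpenMap p) : ∃ ρ, HasIsometricSheets p ρ := by
  obtain ⟨δ, hδ, hiso⟩ := hp.exists_pos_forall_dist_eq
  obtain ⟨s, hs, hlift⟩ := exists_pos_forall_of_isCompact (isCompact_univ (X := X))
    (P := fun s a => ∀ z, dist (p a) z < s → ∃ b, p b = z ∧ dist a b < δ)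
    (fun s t hst a h z hz => h z (hz.trans_le hst)) fun x _ => by
      obtain ⟨s, hs, hsub⟩ := Metric.isOpen_iff.1 (ho _ (Metric.isOpen_ball (x := x) (ε := δ / 2)))
        (p x) (mem_image_of_mem p (Metric.mem_ball_self (half_pos hδ)))
      refine ⟨s / 2, half_pos hs, ?_⟩
      filter_upwards [Metric.ball_mem_nhds x (half_pos hδ),
        hc.continuousAt.preimage_mem_nhds (Metric.ball_mem_nhds (p x) (half_pos hs))]
        with a ha hpa z hz
      rw [Metric.mem_ball] at ha
      rw [mem_preimage, Metric.mem_ball] at hpa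
      obtain ⟨b, hb, rfl⟩ := hsub (show z ∈ Metric.ball (p x) s by
        rw [Metric.mem_ball]
        linarith [dist_triangle_left z (p x) (p a)])
      rw [Metric.mem_ball] at hb
      exact ⟨b, rfl, by linarith [dist_triangle_right a b x]⟩
  refine ⟨min δ s, lt_min hδ hs, fun a b hab => hiso a b (hab.trans_le (min_le_left _ _)),
    fun a z hz => ?_⟩
  obtain ⟨b, rfl, hb⟩ := hlift a (mem_univ a) z (hz.trans_le (min_le_right _ _))
  exact ⟨b, rfl, (hiso a b hb).symm⟩

end IsLocalIsometry

namespace IsCompatibleMetric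

variable {X Y : Type*} [TopologicalSpace X] [CompactSpace X] [MetricSpace Y] {m : MetricSpace X}

theorem exists_forall_dist_lt (hm : IsCompatibleMetric m) {g : ℕ → X → Y}
    (hg : ∀ i, Continuous (g i)) (hsep : ∀ x y, (∀ i, g i x = g i y) → x = y) {δ : ℝ} (hδ : 0 < δ) :
    ∃ n : ℕ, ∀ x y, (∀ i ≤ n, dist (g i x) (g i y) < 1 / ((n : ℝ) + 1)) → m.dist x y < δ := by
  unfold IsCompatibleMetric at hm
  subst hm
  obtain ⟨n, hn⟩ := exists_forall_of_isCompact
    (isClosed_le continuous_const (continuous_dist (α := X))).isCompact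
    (K := {w : X × X | δ ≤ dist w.1 w.2})
    (P := fun n w => ∃ i ≤ n, 1 / ((n : ℝ) + 1) < dist (g i w.1) (g i w.2))
    (fun k l hkl w ⟨i, hi, hw⟩ => ⟨i, hi.trans hkl, (Nat.one_div_le_one_div hkl).trans_lt hw⟩)
    fun w hw => by
      obtain ⟨i, hi⟩ : ∃ i, g i w.1 ≠ g i w.2 := by
        by_contra! hall
        rw [mem_ofPred_eq, hsep _ _ hall, dist_self] at hw
        exact hw.not_gt hδ
      obtain ⟨k, hk⟩ := exists_nat_one_div_lt (dist_pos.2 hi)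
      have hcont : Continuous fun w : X × X => dist (g i w.1) (g i w.2) := by
        have := hg i
        fun_prop
      refine ⟨max i k, ?_⟩
      filter_upwards [continuous_const.continuousAt.eventually_lt hcont.continuousAt hk] with v hv
      exact ⟨i, le_max_left _ _, (Nat.one_div_le_one_div (le_max_right i k)).trans_lt hv⟩
  refine ⟨n, fun x y hxy => ?_⟩
  by_contra! hle
  obtain ⟨i, hi, hlt⟩ := hn (x, y) hle
  exact lt_asymm (hxy i hi) hlt

theorem exists_pos_forall_dist_lt (hm : IsCompatibleMetric m) {g : X → Y}
    (hg : Continuous g) {η : ℝ} (hη : 0 < η) :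
    ∃ e > 0, ∀ x y, m.dist x y ≤ e → dist (g x) (g y) < η := by
  unfold IsCompatibleMetric at hm
  subst hm
  obtain ⟨e, he, h⟩ := Metric.uniformContinuous_iff.1
    (CompactSpace.uniformContinuous_of_continuous hg) η hη
  exact ⟨e / 2, half_pos he, fun x y hxy => h (hxy.trans_lt (half_lt_self he))⟩

end IsCompatibleMetric

/-- The terms `z 0, …, z n` form an orbit of the correspondence `π, φ`; the later terms are
arbitrary. Total sequences rather than tuples are used so that the points of the limit space are
partial orbits of every length. -/
def IsPartialOrbit {X₁ X₀ : Type*} (π φ : X₁ → X₀) (n : ℕ) (z : ℕ → X₁) : Prop :=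
  ∀ i < n, π (z i) = φ (z (i + 1))

/-- Two partial orbits that stay within `r` of each other: one step of a chain of orbits. -/
structure OrbitStep {X₁ X₀ : Type*} [MetricSpace X₁] (π φ : X₁ → X₀) (r : ℝ) (n : ℕ)
    (z w : ℕ → X₁) : Prop where
  left : IsPartialOrbit π φ n z
  right : IsPartialOrbit π φ n w
  dist_le : ∀ i ≤ n, dist (z i) (w i) ≤ r

section PartialOrbit

variable {X₀ X₁ : Type*} {π φ : X₁ → X₀} {m n : ℕ} {z w : ℕ → X₁}

namespace IsPartialOrbit

theorem of_le (hz : IsPartialOrbit π φ n z) (hmn : m ≤ n) : IsPartialOrbit π φ m z :=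
  fun i hi => hz i (hi.trans_le hmn)

theorem update (hz : IsPartialOrbit π φ n z) {a : X₁} (ha : π (z n) = φ a) :
    IsPartialOrbit π φ (n + 1) (Function.update z (n + 1) a) := by
  intro i hi
  rcases Nat.lt_succ_iff_lt_or_eq.1 hi with hi | rfl
  · simpa [hi.ne, (hi.trans n.lt_succ_self).ne] using hz i hi
  · simpa using ha

theorem exists_of_surjective (hπ : Function.Surjective π) (φ : X₁ → X₀) (n : ℕ) (a : X₁) :
    ∃ z, IsPartialOrbit π φ n z ∧ z n = a := by
  induction n generalizing a with
  | zero => exact ⟨fun _ => a, fun i hi => absurd hi i.not_lt_zero, rfl⟩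
  | succ n ih =>
    obtain ⟨b, hb⟩ := hπ (φ a)
    obtain ⟨z, hz, rfl⟩ := ih b
    exact ⟨Function.update z (n + 1) a, hz.update hb, by simp⟩

end IsPartialOrbit

variable [MetricSpace X₁] {r : ℝ}

theorem IsPartialOrbit.orbitStep_self (hz : IsPartialOrbit π φ n z) (hr : 0 ≤ r) :
    OrbitStep π φ r n z z :=
  ⟨hz, hz, fun i _ => by rwa [dist_self]⟩

theorem OrbitStep.symm (h : OrbitStep π φ r n z w) : OrbitStep π φ r n w z :=
  ⟨h.right, h.left, fun i hi => by rw [dist_comm]; exact h.dist_le i hi⟩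

theorem OrbitStep.update (h : OrbitStep π φ r n z w) {a b : X₁} (ha : π (z n) = φ a)
    (hb : π (w n) = φ b) (hab : dist a b ≤ r) :
    OrbitStep π φ r (n + 1) (Function.update z (n + 1) a) (Function.update w (n + 1) b) := by
  refine ⟨h.left.update ha, h.right.update hb, fun i hi => ?_⟩
  rcases Nat.le_succ_iff.1 hi with hi | rfl
  · simpa [(Nat.lt_succ_of_le hi).ne] using h.dist_le i hi
  · simpa using hab

theorem Steps.isPartialOrbit_right {N : ℕ} (h : Steps (OrbitStep π φ r n) N z w)
    (hz : IsPartialOrbit π φ n z) : IsPartialOrbit π φ n w := by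
  obtain ⟨ζ, rfl, rfl, hζ⟩ := h
  cases N with
  | zero => exact hz
  | succ N => exact (hζ N N.lt_succ_self).right

variable [MetricSpace X₀] {c ρ : ℝ}

namespace IsPartialOrbit

theorem dist_le_pow_mul (hπ : HasIsometricSheets π ρ) (hφ : IsBackwardContracting c φ)
    (hz : IsPartialOrbit π φ n z) (hw : IsPartialOrbit π φ n w)
    (h : ∀ i ≤ n, dist (z i) (w i) < ρ) {i : ℕ} (hi : i ≤ n) :
    dist (z i) (w i) ≤ c ^ (n - i) * dist (z n) (w n) := by
  induction n with
  | zero => simp [Nat.le_zero.1 hi]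
  | succ n ih =>
    rcases Nat.le_succ_iff.1 hi with hin | rfl
    · have hcontract : dist (z n) (w n) ≤ c * dist (z (n + 1)) (w (n + 1)) := by
        rw [← hπ.isometric _ _ (h n n.le_succ), hz n n.lt_succ_self, hw n n.lt_succ_self]
        exact hφ.2.2 _ _
      calc dist (z i) (w i) ≤ c ^ (n - i) * dist (z n) (w n) :=
            ih (hz.of_le n.le_succ) (hw.of_le n.le_succ) (fun j hj => h j (hj.trans n.le_succ)) hin
        _ ≤ c ^ (n - i) * (c * dist (z (n + 1)) (w (n + 1))) :=
            mul_le_mul_of_nonneg_left hcontract (pow_nonneg hφ.1.le _)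
        _ = c ^ (n + 1 - i) * dist (z (n + 1)) (w (n + 1)) := by
            rw [Nat.sub_add_comm hin, pow_succ, mul_assoc]
    · simp

theorem dist_le (hπ : HasIsometricSheets π ρ) (hφ : IsBackwardContracting c φ)
    (hz : IsPartialOrbit π φ n z) (hw : IsPartialOrbit π φ n w)
    (h : ∀ i ≤ n, dist (z i) (w i) < ρ) {i : ℕ} (hi : i ≤ n) :
    dist (z i) (w i) ≤ dist (z n) (w n) :=
  (hz.dist_le_pow_mul hπ hφ hw h hi).trans
    (mul_le_of_le_one_left dist_nonneg (pow_le_one₀ hφ.1.le hφ.2.1.le))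

theorem eq_of_dist_lt (hπ : HasIsometricSheets π ρ) (hφ : IsBackwardContracting c φ)
    (hz : IsPartialOrbit π φ n z) (hw : IsPartialOrbit π φ n w)
    (h : ∀ i ≤ n, dist (z i) (w i) < ρ) (hn : z n = w n) {i : ℕ} (hi : i ≤ n) : z i = w i := by
  simpa [hn] using hz.dist_le hπ hφ hw h hi

theorem exists_orbitStep (hπ : HasIsometricSheets π ρ) (hφ : IsBackwardContracting c φ)
    (hr : r < ρ) (hz : IsPartialOrbit π φ n z) {v : ℕ → X₁} (hv : dist (z n) (v n) ≤ r) :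
    ∃ w, OrbitStep π φ r n z w ∧ ∀ i ≥ n, w i = v i := by
  induction n generalizing v with
  | zero =>
    refine ⟨v, ⟨hz, fun i hi => absurd hi i.not_lt_zero, fun i hi => ?_⟩, fun i _ => rfl⟩
    rwa [Nat.le_zero.1 hi]
  | succ n ih =>
    have hdist : dist (π (z n)) (φ (v (n + 1))) ≤ r := by
      rw [hz n n.lt_succ_self]
      exact ((hφ.2.2 _ _).trans (mul_le_of_le_one_left dist_nonneg hφ.2.1.le)).trans hv
    obtain ⟨b, hb, hzb⟩ := hπ.exists_lift _ _ (hdist.trans_lt hr)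
    obtain ⟨w, hw, hwv⟩ := ih (hz.of_le n.le_succ) (v := Function.update v n b) (by simpa [hzb])
    have hwn : w n = b := by simpa using hwv n le_rfl
    have hwv' : ∀ i ≥ n + 1, w i = v i := fun i hi => by
      simpa [show i ≠ n by omega] using hwv i (by omega)
    refine ⟨w, ⟨hz, fun i hi => ?_, fun i hi => ?_⟩, hwv'⟩
    · rcases Nat.lt_succ_iff_lt_or_eq.1 hi with hi | rfl
      · exact hw.right i hi
      · rw [hwn, hb, hwv' _ le_rfl]
    · rcases Nat.le_succ_iff.1 hi with hi | rfl
      · exact hw.dist_le i hi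
      · rwa [hwv' _ le_rfl]

theorem exists_steps (hπ : HasIsometricSheets π ρ) (hφ : IsBackwardContracting c φ)
    (hr : r < ρ) (hz : IsPartialOrbit π φ n z) {v : ℕ → X₁} {N : ℕ}
    (hv : Steps (fun a b => dist a b ≤ r) (N + 1) (z n) (v n)) :
    ∃ w, Steps (OrbitStep π φ r n) (N + 1) z w ∧ ∀ i ≥ n, w i = v i := by
  obtain ⟨u, hu0, huN, hu⟩ := hv
  induction N generalizing v with
  | zero =>
    obtain ⟨w, hw, hwv⟩ := hz.exists_orbitStep hπ hφ hr (by simpa [hu0, huN] using hu 0)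
    exact ⟨w, .single hw, hwv⟩
  | succ N ih =>
    obtain ⟨w, hw, hwu⟩ := ih (v := Function.update v n (u (N + 1))) (by simp)
      fun j hj => hu j (hj.trans (N + 1).lt_succ_self)
    have hwn : w n = u (N + 1) := by simpa using hwu n le_rfl
    obtain ⟨w', hw', hwv⟩ := (hw.isPartialOrbit_right hz).exists_orbitStep hπ hφ hr (v := v)
      (by simpa [hwn, huN] using hu (N + 1) (N + 1).lt_succ_self)
    exact ⟨w', hw.trans (.single hw'), hwv⟩

end IsPartialOrbit

theorem OrbitStep.dist_le_mul_pow (hπ : HasIsometricSheets π ρ) (hφ : IsBackwardContracting c φ)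
    (hr : r < ρ) (h : OrbitStep π φ r n z w) {i : ℕ} (hi : i ≤ n) :
    dist (z i) (w i) ≤ r * c ^ (n - i) := by
  rw [mul_comm]
  exact (h.left.dist_le_pow_mul hπ hφ h.right (fun j hj => (h.dist_le j hj).trans_lt hr) hi).trans
    (mul_le_mul_of_nonneg_left (h.dist_le n le_rfl) (pow_nonneg hφ.1.le _))

theorem Steps.dist_le_mul_pow (hπ : HasIsometricSheets π ρ) (hφ : IsBackwardContracting c φ)
    (hr : r < ρ) {N : ℕ} (h : Steps (OrbitStep π φ r n) N z w) {i : ℕ} (hi : i ≤ n) :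
    dist (z i) (w i) ≤ N * r * c ^ (n - i) := by
  obtain ⟨ζ, rfl, rfl, hζ⟩ := h
  calc dist (ζ 0 i) (ζ N i) ≤ ∑ _j ∈ Finset.range N, r * c ^ (n - i) :=
        dist_le_range_sum_of_dist_le (f := fun j => ζ j i) N
          fun hj => (hζ _ hj).dist_le_mul_pow hπ hφ hr hi
    _ = N * r * c ^ (n - i) := by simp [mul_assoc]

theorem dist_le_mul_pow_of_isPreconnected (hπ : HasIsometricSheets π ρ)
    (hφ : IsBackwardContracting c φ) {S : Set (ℕ → X₁)} (hS : IsPreconnected S)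
    (horb : ∀ w ∈ S, IsPartialOrbit π φ n w) (hr : r < ρ) (hz : z ∈ S)
    (hdist : ∀ w ∈ S, dist (z n) (w n) ≤ r) (hw : w ∈ S) {i : ℕ} (hi : i ≤ n) :
    dist (z i) (w i) ≤ r * c ^ (n - i) := by
  induction n generalizing r with
  | zero => simpa [Nat.le_zero.1 hi] using hdist w hw
  | succ n ih =>
    rcases Nat.le_succ_iff.1 hi with hin | rfl
    · have hr0 : 0 ≤ r := dist_nonneg.trans (hdist z hz)
      have hcr : c * r < ρ := (mul_le_of_le_one_left hr0 hφ.2.1.le).trans_lt hr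
      have hcontract : ∀ w ∈ S, dist (z n) (w n) < ρ → dist (z n) (w n) ≤ c * r := by
        intro w hw hlt
        rw [← hπ.isometric _ _ hlt, horb z hz n n.lt_succ_self, horb w hw n n.lt_succ_self]
        exact (hφ.2.2 _ _).trans (mul_le_mul_of_nonneg_left (hdist w hw) hφ.1.le)
      have hdist' : ∀ w ∈ S, dist (z n) (w n) ≤ c * r :=
        forall_le_of_isPreconnected_of_gap hS (by fun_prop) hcr hcontract hz
          (by simpa using mul_nonneg hφ.1.le hr0)
      calc dist (z i) (w i) ≤ c * r * c ^ (n - i) :=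
            ih (fun w hw => (horb w hw).of_le n.le_succ) hcr hdist' hin
        _ = r * c ^ (n + 1 - i) := by rw [Nat.sub_add_comm hin, pow_succ]; ring
    · simpa using hdist w hw

end PartialOrbit

/-- The partial orbit `x` is carried to `y` along the path `γ` of its last terms: some path from
`x` to `y` consists of partial orbits whose `n`-th terms follow `γ`. -/
def PathTransport {X₁ X₀ : Type*} [TopologicalSpace X₁] (π φ : X₁ → X₀) (n : ℕ) (γ : C(I, X₁))
    (x y : ℕ → X₁) : Prop :=
  ∃ Γ : Path x y, (∀ t, IsPartialOrbit π φ n (Γ t)) ∧ ∀ t, Γ t n = γ t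

namespace PathTransport

section Topological

variable {X₀ X₁ : Type*} [TopologicalSpace X₁] {n : ℕ} {x y x' y' w : ℕ → X₁}

theorem refl {π φ : X₁ → X₀} (hx : IsPartialOrbit π φ n x) :
    PathTransport π φ n (Path.refl (x n) : C(I, X₁)) x x :=
  ⟨Path.refl x, fun _ => hx, fun _ => rfl⟩

theorem trans {π φ : X₁ → X₀} {a b e : X₁} {p : Path a b} {q : Path b e}
    (h : PathTransport π φ n (p : C(I, X₁)) x y) (h' : PathTransport π φ n (q : C(I, X₁)) y w) :
    PathTransport π φ n (p.trans q : C(I, X₁)) x w := by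
  obtain ⟨Γ, hΓ, hp⟩ := h
  obtain ⟨Γ', hΓ', hq⟩ := h'
  refine ⟨Γ.trans Γ', fun t => ?_, fun t => ?_⟩
  · rw [Path.trans_apply]
    split_ifs
    exacts [hΓ _, hΓ' _]
  · change Γ.trans Γ' t n = p.trans q t
    simp only [Path.trans_apply]
    split_ifs
    exacts [hp _, hq _]

theorem isPartialOrbit_right {π φ : X₁ → X₀} {γ : C(I, X₁)} (h : PathTransport π φ n γ x y) :
    IsPartialOrbit π φ n y := by
  obtain ⟨Γ, hΓ, -⟩ := h
  simpa using hΓ 1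

theorem apply_zero {π φ : X₁ → X₀} {γ : C(I, X₁)} (h : PathTransport π φ n γ x y) : γ 0 = x n := by
  obtain ⟨Γ, -, hΓ⟩ := h
  rw [← hΓ, Γ.source]

theorem apply_one {π φ : X₁ → X₀} {γ : C(I, X₁)} (h : PathTransport π φ n γ x y) : γ 1 = y n := by
  obtain ⟨Γ, -, hΓ⟩ := h
  rw [← hΓ, Γ.target]

variable [TopologicalSpace X₀] {π φ : C(X₁, X₀)} {γ γ' : C(I, X₁)}

theorem exists_pred (h : PathTransport π φ (n + 1) γ x y) :
    ∃ g : C(I, X₁), PathTransport π φ n g x y ∧ π.comp g = φ.comp γ := by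
  obtain ⟨Γ, hΓ, hγ⟩ := h
  refine ⟨⟨fun t => Γ t n, by fun_prop⟩, ⟨Γ, fun t => (hΓ t).of_le n.le_succ, fun _ => rfl⟩, ?_⟩
  ext t
  simpa [hγ t] using hΓ t n n.lt_succ_self

theorem eq_of_homotopicRel (hπ : IsCoveringMap π) (h : PathTransport π φ n γ x y)
    (h' : PathTransport π φ n γ' x' y') (hx : ∀ i ≤ n, x i = x' i)
    (hγ : γ.HomotopicRel γ' {0, 1}) : ∀ i ≤ n, y i = y' i := by
  induction n generalizing γ γ' with
  | zero =>
    intro i hi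
    rw [Nat.le_zero.1 hi, ← h.apply_one, ← h'.apply_one]
    exact hγ.fst_eq_snd (by simp)
  | succ n ih =>
    obtain ⟨g, hg, hgγ⟩ := h.exists_pred
    obtain ⟨g', hg', hgγ'⟩ := h'.exists_pred
    have hstart : g 0 = g' 0 := by rw [hg.apply_zero, hg'.apply_zero, hx n n.le_succ]
    have hgg' : g.HomotopicRel g' {0, 1} := by
      refine (hπ.homotopicRel_iff_comp ⟨0, by simp, hstart⟩).2 ?_
      change (π.comp g).HomotopicRel (π.comp g') _
      rw [hgγ, hgγ']
      exact hγ.comp_continuousMap φ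
    intro i hi
    rcases Nat.le_succ_iff.1 hi with hi | rfl
    · exact ih hg hg' (fun i hi => hx i (hi.trans n.le_succ)) hgg' i hi
    · rw [← h.apply_one, ← h'.apply_one]
      exact hγ.fst_eq_snd (by simp)

theorem _root_.IsPartialOrbit.exists_pathLift (hπ : IsCoveringMap π) (hx : IsPartialOrbit π φ n x)
    (V : C(I, ℕ → X₁)) (hV : ∀ i ≥ n, V 0 i = x i) :
    ∃ Γ : C(I, ℕ → X₁), Γ 0 = x ∧ (∀ t, IsPartialOrbit π φ n (Γ t)) ∧
      ∀ t, ∀ i ≥ n, Γ t i = V t i := by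
  induction n generalizing V with
  | zero => exact ⟨V, funext fun i => hV i i.zero_le, fun t i hi => absurd hi i.not_lt_zero,
      fun _ _ _ => rfl⟩
  | succ n ih =>
    obtain ⟨g, hg, hg0⟩ := hπ.exists_path_lifts ⟨fun t => φ (V t (n + 1)), by fun_prop⟩ (x n) (by
      simpa [hV (n + 1) le_rfl] using (hx n n.lt_succ_self).symm)
    obtain ⟨Γ, hΓ0, hΓ, hΓV⟩ := ih (hx.of_le n.le_succ)
      ⟨fun t => Function.update (V t) n (g t), by fun_prop⟩ fun i hi => by
        rcases eq_or_lt_of_le hi with rfl | hi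
        · simpa using hg0
        · simpa [hi.ne'] using hV i hi
    have hΓV' : ∀ t, ∀ i ≥ n + 1, Γ t i = V t i := fun t i hi => by
      simpa [show i ≠ n by omega] using hΓV t i (by omega)
    refine ⟨Γ, hΓ0, fun t i hi => ?_, hΓV'⟩
    rcases Nat.lt_succ_iff_lt_or_eq.1 hi with hi | rfl
    · exact hΓ t i hi
    · rw [hΓV t i le_rfl, hΓV' t _ le_rfl]
      simpa using congrFun hg t

theorem _root_.IsPartialOrbit.exists_pathTransport [PathConnectedSpace X₁] (hπ : IsCoveringMap π)
    (hx : IsPartialOrbit π φ n x) (p : Path (x n) (y n)) :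
    ∃ y', PathTransport π φ n (p : C(I, X₁)) x y' ∧ ∀ i ≥ n, y' i = y i := by
  let V : Path x y := .pi (Function.update (fun i => PathConnectedSpace.somePath (x i) (y i)) n p)
  obtain ⟨Γ, hΓ0, hΓ, hΓV⟩ := hx.exists_pathLift hπ V.toContinuousMap fun i _ => by simp
  exact ⟨Γ 1, ⟨⟨Γ, hΓ0, rfl⟩, hΓ, fun t => (hΓV t n le_rfl).trans (by simp [V, Path.pi])⟩,
    fun i hi => (hΓV 1 i hi).trans (by simp)⟩

end Topological

section Metric

variable {X₀ X₁ : Type*} [MetricSpace X₀] [MetricSpace X₁] {c ρ r : ℝ} {n : ℕ} {x y : ℕ → X₁}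

theorem dist_le {π φ : X₁ → X₀} {γ : C(I, X₁)} (hπ : HasIsometricSheets π ρ)
    (hφ : IsBackwardContracting c φ) (h : PathTransport π φ n γ x y) (hr : r < ρ)
    (hγ : ∀ t, dist (x n) (γ t) ≤ r) {i : ℕ} (hi : i ≤ n) : dist (x i) (y i) ≤ r * c ^ (n - i) := by
  obtain ⟨Γ, hΓ, hΓγ⟩ := h
  refine dist_le_mul_pow_of_isPreconnected hπ hφ (isPreconnected_range Γ.continuous)
    (forall_mem_range.2 hΓ) hr ⟨0, Γ.source⟩ (forall_mem_range.2 fun t => ?_) ⟨1, Γ.target⟩ hi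
  rw [hΓγ]
  exact hγ t

theorem exists_forall_steps {π φ : X₁ → X₀} (hπ : HasIsometricSheets π ρ)
    (hφ : IsBackwardContracting c φ) (hr0 : 0 < r) (hr : r < ρ) (γ : C(I, X₁)) :
    ∃ m, ∀ n x y, PathTransport π φ n γ x y → Steps (OrbitStep π φ r n) m x y := by
  suffices h : ∃ m, ∀ n (Γ : C(I, ℕ → X₁)), (∀ t, IsPartialOrbit π φ n (Γ t)) →
      (∀ t, Γ t n = γ t) → Steps (OrbitStep π φ r n) m (Γ 0) (Γ 1) by
    obtain ⟨m, hm⟩ := h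
    refine ⟨m, fun n x y ⟨Γ, hΓ, hΓγ⟩ => ?_⟩
    simpa using hm n Γ hΓ hΓγ
  refine isPreconnected_univ.induction₂ (fun s t => ∃ m, ∀ n (Γ : C(I, ℕ → X₁)),
    (∀ t, IsPartialOrbit π φ n (Γ t)) → (∀ t, Γ t n = γ t) →
      Steps (OrbitStep π φ r n) m (Γ s) (Γ t)) ?_ ?_ ?_ (mem_univ 0) (mem_univ 1)
  · intro s _
    obtain ⟨a, b, hs, hab, hball⟩ := exists_Icc_mem_subset_of_mem_nhds
      (γ.continuous.continuousAt.preimage_mem_nhds (Metric.closedBall_mem_nhds (γ s) hr0))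
    filter_upwards [mem_nhdsWithin_of_mem_nhds hab] with t ht
    refine ⟨1, fun n Γ hΓ hΓγ => .single ⟨hΓ s, hΓ t, fun i hi => ?_⟩⟩
    refine (dist_le_mul_pow_of_isPreconnected hπ hφ
      (isPreconnected_Icc.image Γ (Γ.continuous.continuousOn)) (forall_mem_image.2 fun u _ => hΓ u)
      hr (mem_image_of_mem Γ hs) (forall_mem_image.2 fun u hu => ?_) (mem_image_of_mem Γ ht)
      hi).trans (mul_le_of_le_one_right hr0.le (pow_le_one₀ hφ.1.le hφ.2.1.le))
    rw [hΓγ, hΓγ, dist_comm]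
    exact hball hu
  · rintro s t u - - - ⟨m, hm⟩ ⟨m', hm'⟩
    exact ⟨m + m', fun n Γ hΓ hΓγ => (hm n Γ hΓ hΓγ).trans (hm' n Γ hΓ hΓγ)⟩
  · rintro s t - - ⟨m, hm⟩
    exact ⟨m, fun n Γ hΓ hΓγ => (hm n Γ hΓ hΓγ).symm fun _ _ => OrbitStep.symm⟩

end Metric

end PathTransport

theorem OrbitStep.pathTransport {X₀ X₁ : Type*} [MetricSpace X₀] [MetricSpace X₁]
    [PathConnectedSpace X₁] {π φ : C(X₁, X₀)} {c ρ r s : ℝ} {n : ℕ} {x y : ℕ → X₁}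
    (hπ : IsCoveringMap π) (hρ : HasIsometricSheets π ρ) (hφ : IsBackwardContracting c φ)
    (hs : s + r < ρ) (h : OrbitStep π φ r n x y) (p : Path (x n) (y n))
    (hp : ∀ t, dist (x n) (p t) ≤ s) : PathTransport π φ n (p : C(I, X₁)) x y := by
  have hs0 : 0 ≤ s := dist_nonneg.trans (hp 0)
  have hr0 : 0 ≤ r := dist_nonneg.trans (h.dist_le n le_rfl)
  obtain ⟨y', htransport, hy'y⟩ := h.left.exists_pathTransport hπ p
  have hclose : ∀ i ≤ n, dist (y' i) (y i) < ρ := fun i hi => by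
    have hsi : dist (x i) (y' i) ≤ s :=
      (htransport.dist_le hρ hφ (by linarith) hp hi).trans
        (mul_le_of_le_one_right hs0 (pow_le_one₀ hφ.1.le hφ.2.1.le))
    linarith [dist_triangle_left (y' i) (y i) (x i), h.dist_le i hi]
  have heq : y' = y := funext fun i => (le_total i n).elim
    (htransport.isPartialOrbit_right.eq_of_dist_lt hρ hφ h.right hclose (hy'y n le_rfl)) (hy'y i)
  rwa [heq] at htransport

/-- The partial orbits `ζ 0, …, ζ N` form a chain with steps of size `r`, whose last terms are
`z 0, …, z N`. -/
structure IsOrbitChain {X₁ X₀ : Type*} [MetricSpace X₁] (π φ : X₁ → X₀) (r : ℝ) (n N : ℕ)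
    (z : ℕ → X₁) (ζ : ℕ → ℕ → X₁) : Prop where
  isPartialOrbit : IsPartialOrbit π φ n (ζ 0)
  step : ∀ j < N, OrbitStep π φ r n (ζ j) (ζ (j + 1))
  last_eq : ∀ j ≤ N, ζ j n = z j

namespace IsOrbitChain

variable {X₀ X₁ : Type*} [MetricSpace X₁] {c ρ r : ℝ} {n N : ℕ} {z w : ℕ → X₁}
  {ζ : ℕ → ℕ → X₁}

theorem isPartialOrbit_of_le {π φ : X₁ → X₀} (h : IsOrbitChain π φ r n N z ζ) {j : ℕ}
    (hj : j ≤ N) : IsPartialOrbit π φ n (ζ j) := by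
  cases j with
  | zero => exact h.isPartialOrbit
  | succ j => exact (h.step j hj).right

variable [MetricSpace X₀]

theorem exists_of_dist_le {π φ : X₁ → X₀} (hπ : HasIsometricSheets π ρ)
    (hφ : IsBackwardContracting c φ) (hr : 2 * r < ρ) (h : IsOrbitChain π φ r n N z ζ)
    (hw : ∀ j < N, dist (w j) (w (j + 1)) ≤ r) (hzw : ∀ j ≤ N, dist (z j) (w j) ≤ r / 2) :
    ∃ ξ, IsOrbitChain π φ r n N w ξ ∧ ∀ j ≤ N, OrbitStep π φ r n (ζ j) (ξ j) := by
  have hr0 : 0 ≤ r / 2 := dist_nonneg.trans (hzw 0 N.zero_le)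
  have hex : ∀ j, ∃ ξ, j ≤ N → OrbitStep π φ (r / 2) n (ζ j) ξ ∧ ξ n = w j := fun j => by
    by_cases hj : j ≤ N
    · obtain ⟨ξ, hξ, hξw⟩ := (h.isPartialOrbit_of_le hj).exists_orbitStep hπ hφ (r := r / 2)
        (v := fun _ => w j) (by linarith) (by simpa [h.last_eq j hj] using hzw j hj)
      exact ⟨ξ, fun _ => ⟨hξ, hξw n le_rfl⟩⟩
    · exact ⟨w, fun hj' => absurd hj' hj⟩
  choose ξ hξ using hex
  have hclose : ∀ j < N, ∀ i ≤ n, dist (ξ j i) (ξ (j + 1) i) < ρ := fun j hj i hi => by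
    have h₁ := (hξ j hj.le).1.symm.dist_le i hi
    have h₂ := (h.step j hj).dist_le i hi
    have h₃ := (hξ (j + 1) hj).1.dist_le i hi
    linarith [dist_triangle4 (ξ j i) (ζ j i) (ζ (j + 1) i) (ξ (j + 1) i)]
  refine ⟨ξ, ⟨(hξ 0 N.zero_le).1.right, fun j hj => ⟨(hξ j hj.le).1.right,
    (hξ (j + 1) hj).1.right, fun i hi => ?_⟩, fun j hj => (hξ j hj).2⟩, fun j hj =>
    ⟨(hξ j hj).1.left, (hξ j hj).1.right, fun i hi => ((hξ j hj).1.dist_le i hi).trans ?_⟩⟩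
  · calc dist (ξ j i) (ξ (j + 1) i) ≤ dist (ξ j n) (ξ (j + 1) n) :=
          (hξ j hj.le).1.right.dist_le hπ hφ (hξ (j + 1) hj).1.right (hclose j hj) hi
      _ ≤ r := by
          rw [(hξ j hj.le).2, (hξ (j + 1) hj).2]
          exact hw j hj
  · linarith

end IsOrbitChain

/-- Every chain of partial orbits over `z` extends by the last terms `a` and `b` at its ends to
partial orbits that are joined by `m` steps, whatever the length of the partial orbits. -/
def ChainsExtend {X₁ X₀ : Type*} [MetricSpace X₁] (π φ : X₁ → X₀) (r : ℝ) (N m : ℕ)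
    (z : ℕ → X₁) (a b : X₁) : Prop :=
  ∀ n ζ, IsOrbitChain π φ r n N z ζ → Steps (OrbitStep π φ r (n + 1)) m
    (Function.update (ζ 0) (n + 1) a) (Function.update (ζ N) (n + 1) b)

theorem ChainsExtend.of_dist_le {X₀ X₁ : Type*} [MetricSpace X₀] [MetricSpace X₁] {π φ : X₁ → X₀}
    {c ρ r : ℝ} {N m : ℕ} {z w : ℕ → X₁} {a b a' b' : X₁} (hπ : HasIsometricSheets π ρ)
    (hφ : IsBackwardContracting c φ) (hr : 2 * r < ρ)
    (h : ChainsExtend π φ r N m w a' b') (hw : ∀ j < N, dist (w j) (w (j + 1)) ≤ r)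
    (hwa : π (w 0) = φ a') (hwb : π (w N) = φ b') (hza : π (z 0) = φ a) (hzb : π (z N) = φ b)
    (hzw : ∀ j ≤ N, dist (z j) (w j) ≤ r / 2) (haa' : dist a a' ≤ r) (hbb' : dist b b' ≤ r) :
    ChainsExtend π φ r N (1 + m + 1) z a b := by
  intro n ζ hζ
  obtain ⟨ξ, hξ, hζξ⟩ := hζ.exists_of_dist_le hπ hφ hr hw hzw
  have hfirst := (hζξ 0 N.zero_le).update (by rw [hζ.last_eq 0 N.zero_le, hza])
    (by rw [hξ.last_eq 0 N.zero_le, hwa]) haa'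
  have hlast := (hζξ N le_rfl).update (by rw [hζ.last_eq N le_rfl, hzb])
    (by rw [hξ.last_eq N le_rfl, hwb]) hbb'
  exact (Steps.single hfirst).trans (h n ξ hξ) |>.trans (.single hlast.symm)

/-- `r` is a scale, small compared with `ρ`, at which the steps of chains are filled in by paths of
radius `ρ / 4`. -/
structure IsFillingScale (X : Type*) [MetricSpace X] (ρ r : ℝ) : Prop where
  pos : 0 < r
  four_mul_le : 4 * r ≤ ρ
  exists_path : ∀ x y : X, dist x y ≤ r → ∃ γ : Path x y, ∀ t, dist x (γ t) ≤ ρ / 4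

namespace IsFillingScale

variable {X : Type*} [MetricSpace X] {ρ r : ℝ}

theorem exists_of_pos [CompactSpace X] [LocallyPathConnectedSpace X] (hρ : 0 < ρ) :
    ∃ r, IsFillingScale X ρ r := by
  obtain ⟨r, hr, h⟩ := exists_path_forall_dist_le (X := X) (show 0 < ρ / 4 by positivity)
  refine ⟨min r (ρ / 4), lt_min hr (by positivity), ?_, fun x y hxy => ?_⟩
  · linarith [min_le_right r (ρ / 4)]
  · exact h x y (hxy.trans (min_le_left _ _))

theorem two_mul_lt (h : IsFillingScale X ρ r) : 2 * r < ρ := by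
  linarith [h.pos, h.four_mul_le]

theorem lt (h : IsFillingScale X ρ r) : r < ρ := by
  linarith [h.pos, h.four_mul_le]

theorem quarter_add_lt (h : IsFillingScale X ρ r) : ρ / 4 + r < ρ := by
  linarith [h.pos, h.four_mul_le]

end IsFillingScale

section UniformBound

variable {X₀ X₁ : Type*} [MetricSpace X₀] [MetricSpace X₁] [PathConnectedSpace X₁]
  {π φ : C(X₁, X₀)} {c ρ r : ℝ} {N : ℕ}

theorem exists_path_forall_pathTransport (hπ : IsCoveringMap π) (hρ : HasIsometricSheets π ρ)
    (hφ : IsBackwardContracting c φ) (hr : IsFillingScale X₁ ρ r) {z : ℕ → X₁}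
    (hz : ∀ j < N, dist (z j) (z (j + 1)) ≤ r) :
    ∃ q : Path (z 0) (z N), ∀ n ζ, IsOrbitChain π φ r n N z ζ →
      PathTransport π φ n (q : C(I, X₁)) (ζ 0) (ζ N) := by
  induction N with
  | zero =>
    refine ⟨Path.refl _, fun n ζ h => ?_⟩
    rw [← h.last_eq 0 le_rfl]
    exact .refl h.isPartialOrbit
  | succ N ih =>
    obtain ⟨q, hq⟩ := ih fun j hj => hz j (hj.trans N.lt_succ_self)
    obtain ⟨p, hp⟩ := hr.exists_path _ _ (hz N N.lt_succ_self)
    refine ⟨q.trans p, fun n ζ h => (hq n ζ ⟨h.isPartialOrbit,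
      fun j hj => h.step j (hj.trans N.lt_succ_self), fun j hj => h.last_eq j (by omega)⟩).trans ?_⟩
    have hN := h.last_eq N N.le_succ
    exact (h.step N N.lt_succ_self).pathTransport hπ hρ hφ hr.quarter_add_lt
      (p.cast hN (h.last_eq (N + 1) le_rfl)) (by simpa [hN] using hp)

theorem exists_chainsExtend (hπ : IsCoveringMap π) (hρ : HasIsometricSheets π ρ)
    (hφ : IsBackwardContracting c φ) (hr : IsFillingScale X₁ ρ r)
    (hrec : ∀ x, Function.Surjective (FundamentalGroup.map φ x)) {z : ℕ → X₁} {a b : X₁}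
    (hz : ∀ j < N, dist (z j) (z (j + 1)) ≤ r) (ha : π (z 0) = φ a) (hb : π (z N) = φ b) :
    ∃ m, ChainsExtend π φ r N m z a b := by
  obtain ⟨q, hq⟩ := exists_path_forall_pathTransport hπ hρ hφ hr hz
  obtain ⟨ω, hω⟩ := exists_path_map_homotopic (hrec a)
    ((q.map π.continuous).cast ha.symm hb.symm)
  obtain ⟨m, hm⟩ := PathTransport.exists_forall_steps hρ hφ hr.pos hr.lt (ω : C(I, X₁))
  refine ⟨m, fun n ζ h => hm _ _ _ ?_⟩
  have hx : IsPartialOrbit π φ (n + 1) (Function.update (ζ 0) (n + 1) a) :=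
    h.isPartialOrbit.update (by rw [h.last_eq 0 N.zero_le, ha])
  obtain ⟨y, hy, hyb⟩ := hx.exists_pathTransport hπ (y := Function.update (ζ N) (n + 1) b)
    (ω.cast (by simp) (by simp))
  -- The time-`n` track `g` of the transport along `ω` satisfies `π ∘ g = φ ∘ ω ≃ π ∘ q`.
  obtain ⟨g, hg, hgω⟩ := hy.exists_pred
  have hgq : g.HomotopicRel (q : C(I, X₁)) {0, 1} := by
    refine (hπ.homotopicRel_iff_comp ⟨0, by simp, ?_⟩).2 ?_
    · rw [hg.apply_zero, (hq n ζ h).apply_zero]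
      simp
    · change (π.comp g).HomotopicRel _ _
      rw [hgω]
      exact hω
  have hyζ : ∀ i ≤ n, y i = ζ N i := hg.eq_of_homotopicRel hπ (hq n ζ h)
    (fun i hi => by simp [show i ≠ n + 1 by omega]) hgq
  have heq : y = Function.update (ζ N) (n + 1) b := funext fun i => by
    rcases le_or_gt i n with hi | hi
    · simp [hyζ i hi, show i ≠ n + 1 by omega]
    · exact hyb i hi
  rwa [heq] at hy

theorem exists_forall_chainsExtend [CompactSpace X₁] (hπ : IsCoveringMap π)
    (hρ : HasIsometricSheets π ρ) (hφ : IsBackwardContracting c φ) (hr : IsFillingScale X₁ ρ r)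
    (hrec : ∀ x, Function.Surjective (FundamentalGroup.map φ x)) (N : ℕ) :
    ∃ m, ∀ (z : ℕ → X₁) (a b : X₁), (∀ j < N, dist (z j) (z (j + 1)) ≤ r) → π (z 0) = φ a →
      π (z N) = φ b → ChainsExtend π φ r N m z a b := by
  let D : Set ((ℕ → X₁) × X₁ × X₁) := {v | (∀ j < N, dist (v.1 j) (v.1 (j + 1)) ≤ r) ∧
    π (v.1 0) = φ v.2.1 ∧ π (v.1 N) = φ v.2.2}
  have hchain : IsClosed {v : (ℕ → X₁) × X₁ × X₁ | ∀ j < N, dist (v.1 j) (v.1 (j + 1)) ≤ r} := by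
    simp only [ofPred_forall]
    exact isClosed_iInter fun j => isClosed_iInter fun _ => isClosed_le (by fun_prop) (by fun_prop)
  have hD : IsCompact D := (hchain.inter ((isClosed_eq (by fun_prop) (by fun_prop)).inter
    (isClosed_eq (by fun_prop) (by fun_prop)))).isCompact
  have hlocal : ∀ v ∈ D, ∃ m, ∀ᶠ u in 𝓝 v, u ∈ D → ChainsExtend π φ r N m u.1 u.2.1 u.2.2 := by
    rintro ⟨w, a', b'⟩ ⟨hw, hwa, hwb⟩
    obtain ⟨m, hm⟩ := exists_chainsExtend hπ hρ hφ hr hrec hw hwa hwb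
    have hnear : ∀ᶠ u : (ℕ → X₁) × X₁ × X₁ in 𝓝 (w, a', b'),
        (∀ j ∈ Finset.range (N + 1), dist (u.1 j) (w j) < r / 2) ∧ dist u.2.1 a' < r ∧
          dist u.2.2 b' < r := by
      refine .and ((Filter.eventually_all_finset _).2 fun j _ => ?_) (.and ?_ ?_)
      all_goals exact ContinuousAt.eventually_lt (by fun_prop) continuousAt_const (by simp [hr.pos])
    refine ⟨1 + m + 1, hnear.mono fun u hu huD => ?_⟩
    exact hm.of_dist_le hρ hφ hr.two_mul_lt hw hwa hwb huD.2.1 huD.2.2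
      (fun j hj => (hu.1 j (Finset.mem_range_succ_iff.2 hj)).le) hu.2.1.le hu.2.2.le
  have hmono : ∀ ⦃k l⦄, k ≤ l → ∀ v, (v ∈ D → ChainsExtend π φ r N k v.1 v.2.1 v.2.2) →
      v ∈ D → ChainsExtend π φ r N l v.1 v.2.1 v.2.2 := fun k l hkl v h hv n ζ hζ => by
    have hlast := (hζ.isPartialOrbit_of_le le_rfl).update (by rw [hζ.last_eq N le_rfl, hv.2.2])
    exact (h hv n ζ hζ).mono (hlast.orbitStep_self hr.pos.le) hkl
  obtain ⟨m, hm⟩ := exists_forall_of_isCompact hD hmono hlocal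
  exact ⟨m, fun z a b hz ha hb => hm (z, a, b) ⟨hz, ha, hb⟩ ⟨hz, ha, hb⟩⟩

theorem exists_forall_steps_succ [CompactSpace X₁] (hπ : IsCoveringMap π)
    (hρ : HasIsometricSheets π ρ) (hφ : IsBackwardContracting c φ) (hr : IsFillingScale X₁ ρ r)
    (hrec : ∀ x, Function.Surjective (FundamentalGroup.map φ x)) (N : ℕ) :
    ∃ M, ∀ n x y, IsPartialOrbit π φ (n + 1) x → IsPartialOrbit π φ (n + 1) y →
      Steps (OrbitStep π φ r n) N x y → Steps (OrbitStep π φ r (n + 1)) M x y := by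
  obtain ⟨M, hM⟩ := exists_forall_chainsExtend hπ hρ hφ hr hrec N
  refine ⟨M, fun n x y hx hy hxy => ?_⟩
  obtain ⟨ζ, rfl, rfl, hζ⟩ := hxy
  simpa using hM (fun j => ζ j n) (ζ 0 (n + 1)) (ζ N (n + 1))
    (fun j hj => (hζ j hj).dist_le n le_rfl) (hx n n.lt_succ_self) (hy n n.lt_succ_self) n ζ
    ⟨hx.of_le n.le_succ, hζ, fun _ _ => rfl⟩

end UniformBound

namespace LimitSpace

section Topology

variable {X₀ X₁ : Type*} {π φ : X₁ → X₀}

theorem ext_coord {x y : LimitSpace π φ} (h : ∀ i, x.1 i = y.1 i) : x = y :=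
  Subtype.ext (funext h)

theorem isPartialOrbit (x : LimitSpace π φ) (n : ℕ) : IsPartialOrbit π φ n x.1 :=
  fun i _ => x.2 i

theorem continuous_coord [TopologicalSpace X₁] (i : ℕ) :
    Continuous fun x : LimitSpace π φ => x.1 i :=
  (continuous_apply i).comp continuous_subtype_val

theorem metrizableSpace [MetricSpace X₁] (π φ : X₁ → X₀) :
    TopologicalSpace.MetrizableSpace (LimitSpace π φ) :=
  have : TopologicalSpace.MetrizableSpace (ℕ → X₁) := UniformSpace.metrizableSpace
  IsEmbedding.subtypeVal.metrizableSpace (X := {x : ℕ → X₁ // ∀ i, π (x i) = φ (x (i + 1))})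

theorem mem_nhds_of_coords [MetricSpace X₁] (x : LimitSpace π φ) (n : ℕ) {δ : ℝ} (hδ : 0 < δ) :
    {y : LimitSpace π φ | ∀ i ≤ n, dist (x.1 i) (y.1 i) < δ} ∈ 𝓝 x := by
  have hfin : ∀ᶠ y : LimitSpace π φ in 𝓝 x, ∀ i ∈ Finset.range (n + 1),
      dist (x.1 i) (y.1 i) < δ := by
    refine (Filter.eventually_all_finset _).2 fun i _ => ?_
    filter_upwards [(continuous_coord i).continuousAt.eventually
      (Metric.ball_mem_nhds (x.1 i) hδ)] with y hy using Metric.mem_ball'.1 hy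
  filter_upwards [hfin] with y hy i hi using hy i (Finset.mem_range_succ_iff.2 hi)

variable [TopologicalSpace X₁] [CompactSpace X₁] [TopologicalSpace X₀] [T2Space X₀]

theorem compactSpace (hπ : Continuous π) (hφ : Continuous φ) : CompactSpace (LimitSpace π φ) := by
  have hclosed : IsClosed {x : ℕ → X₁ | ∀ i, π (x i) = φ (x (i + 1))} := by
    simp only [ofPred_forall]
    exact isClosed_iInter fun i => isClosed_eq (by fun_prop) (by fun_prop)
  exact isCompact_iff_compactSpace.1 hclosed.isCompact

theorem nonempty [Nonempty X₁] (hπ : Continuous π) (hφ : Continuous φ)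
    (hsurj : Function.Surjective π) : Nonempty (LimitSpace π φ) := by
  have hclosed : ∀ n, IsClosed {x | IsPartialOrbit π φ n x} := fun n => by
    simp only [IsPartialOrbit, ofPred_forall]
    exact isClosed_iInter fun i => isClosed_iInter fun _ => isClosed_eq (by fun_prop) (by fun_prop)
  obtain ⟨x, hx⟩ := IsCompact.nonempty_iInter_of_sequence_nonempty_isCompact_isClosed
    (fun n => {x | IsPartialOrbit π φ n x}) (fun n x hx => hx.of_le n.le_succ)
    (fun n => (IsPartialOrbit.exists_of_surjective hsurj φ n (Classical.arbitrary X₁)).imp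
      fun x hx => hx.1)
    (hclosed 0).isCompact hclosed
  exact ⟨⟨x, fun i => mem_iInter.1 hx (i + 1) i i.lt_succ_self⟩⟩

end Topology

/-- The points whose terms up to the `n`-th shadow those of `x`, with an error `B` at time `n` that
decreases by the factor `c` at each earlier time. For fixed `B` the cylinders form a neighbourhood
basis of `x`. -/
def cylinder {X₀ X₁ : Type*} [MetricSpace X₁] {π φ : X₁ → X₀} (B c : ℝ) (n : ℕ)
    (x : LimitSpace π φ) : Set (LimitSpace π φ) :=
  {y | ∀ i ≤ n, dist (x.1 i) (y.1 i) ≤ B * c ^ (n - i)}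

section Cylinder

variable {X₀ X₁ : Type*} [MetricSpace X₁] {π φ : X₁ → X₀} {A B c : ℝ} {n : ℕ}
  {x y z : LimitSpace π φ}

theorem mem_cylinder_self (hc : 0 ≤ c) (hB : 0 ≤ B) : x ∈ cylinder B c n x :=
  fun i _ => by
    rw [dist_self]
    positivity

theorem cylinder_mono (hc : 0 ≤ c) (hAB : A ≤ B) : cylinder A c n x ⊆ cylinder B c n x :=
  fun _ hy i hi => (hy i hi).trans (mul_le_mul_of_nonneg_right hAB (pow_nonneg hc _))

theorem mem_cylinder_trans (hy : y ∈ cylinder A c n x) (hz : z ∈ cylinder B c n y) :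
    z ∈ cylinder (A + B) c n x := fun i hi => by
  rw [add_mul]
  exact (dist_triangle _ _ _).trans (add_le_add (hy i hi) (hz i hi))

theorem cylinder_succ_subset : cylinder B c (n + 1) x ⊆ cylinder (B * c) c n x :=
  fun y hy i hi => by
    rw [mul_assoc, ← pow_succ', ← Nat.sub_add_comm hi]
    exact hy i (hi.trans n.le_succ)

theorem isClosed_cylinder : IsClosed (cylinder B c n x) := by
  simp only [cylinder, ofPred_forall]
  exact isClosed_iInter fun i => isClosed_iInter fun _ =>
    isClosed_le (continuous_const.dist (continuous_coord i)) continuous_const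

variable [CompactSpace (LimitSpace π φ)]

theorem eventually_forall_cylinder_dist_lt (hc : 0 ≤ c) (hc1 : c < 1) (hB : 0 ≤ B)
    {m : MetricSpace (LimitSpace π φ)} (hm : IsCompatibleMetric m) {δ : ℝ} (hδ : 0 < δ) :
    ∀ᶠ n in atTop, ∀ x y : LimitSpace π φ, y ∈ cylinder B c n x → m.dist x y < δ := by
  obtain ⟨k, hk⟩ := hm.exists_forall_dist_lt (g := fun i (x : LimitSpace π φ) => x.1 i)
    continuous_coord (fun x y => ext_coord) hδ
  have hlim : Tendsto (fun n => B * c ^ (n - k)) atTop (𝓝 0) := by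
    simpa using ((tendsto_pow_atTop_nhds_zero_of_lt_one hc hc1).comp
      (tendsto_sub_atTop_nat k)).const_mul B
  filter_upwards [hlim.eventually_lt_const (Nat.one_div_pos_of_nat (n := k)),
    eventually_ge_atTop k] with n hn hkn x y hy
  refine hk x y fun i hi => ?_
  calc dist (x.1 i) (y.1 i) ≤ B * c ^ (n - i) := hy i (hi.trans hkn)
    _ ≤ B * c ^ (n - k) :=
        mul_le_mul_of_nonneg_left (pow_le_pow_of_le_one hc hc1.le (by omega)) hB
    _ < 1 / ((k : ℝ) + 1) := hn

theorem exists_cylinder_subset (hc : 0 ≤ c) (hc1 : c < 1) (hB : 0 ≤ B)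
    {U : Set (LimitSpace π φ)} (hU : U ∈ 𝓝 x) : ∃ n, cylinder B c n x ⊆ U := by
  have := metrizableSpace π φ
  let m := TopologicalSpace.metrizableSpaceMetric (LimitSpace π φ)
  obtain ⟨δ, hδ, hδU⟩ := Metric.mem_nhds_iff.1 hU
  obtain ⟨n, hn⟩ := (eventually_forall_cylinder_dist_lt hc hc1 hB (m := m) rfl hδ).exists
  exact ⟨n, fun y hy => hδU (Metric.mem_ball'.2 (hn x y hy))⟩

end Cylinder

section Refinement

variable {X₀ X₁ : Type*} [MetricSpace X₁] {π φ : X₁ → X₀} {A B c : ℝ} {M n : ℕ}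
  {x y : LimitSpace π φ} {L : ℕ → LimitSpace π φ → LimitSpace π φ → Prop}

theorem mem_cylinder_of_chain {z : ℕ → LimitSpace π φ}
    (hz : ∀ j < M, z (j + 1) ∈ cylinder A c n (z j)) : z M ∈ cylinder (M * A) c n (z 0) := by
  induction M with
  | zero => exact fun i _ => by simp
  | succ M ih =>
    rw [Nat.cast_succ, add_one_mul]
    exact mem_cylinder_trans (ih fun j hj => hz j (hj.trans M.lt_succ_self)) (hz M M.lt_succ_self)

theorem reflTransGen_of_refines (hc : 0 ≤ c) (hA : 0 ≤ A) (hAB : A ≤ B)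
    (hB : (M * A + B) * c ≤ B) (hcyl : ∀ n x y, L n x y → y ∈ cylinder A c n x)
    (hrefine : ∀ n x y, L n x y → Steps (L (n + 1)) M x y) (k : ℕ) (h : L n x y) :
    Relation.ReflTransGen (fun a b => b ∈ cylinder B c n x ∧ L (n + k) a b) x y := by
  induction k generalizing n x y with
  | zero => exact .single ⟨cylinder_mono hc hAB (hcyl n x y h), h⟩
  | succ k ih =>
    obtain ⟨z, rfl, rfl, hz⟩ := hrefine n x y h
    have hsub : ∀ j < M, cylinder B c (n + 1) (z j) ⊆ cylinder B c n (z 0) := fun j hj w hw => by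
      have hzj : z j ∈ cylinder (M * A) c (n + 1) (z 0) := cylinder_mono hc (by gcongr)
        (mem_cylinder_of_chain fun i hi => hcyl _ _ _ (hz i (hi.trans hj)))
      exact cylinder_mono hc hB (cylinder_succ_subset (mem_cylinder_trans hzj hw))
    have hchain : ∀ j ≤ M, Relation.ReflTransGen
        (fun a b => b ∈ cylinder B c n (z 0) ∧ L (n + (k + 1)) a b) (z 0) (z j) := by
      intro j hj
      induction j with
      | zero => exact .refl
      | succ j ihj =>
        refine (ihj (Nat.le_of_succ_le hj)).trans
          (Relation.ReflTransGen.mono (fun a b hab => ?_) _ _ (ih (hz j hj)))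
        exact ⟨hsub j hj hab.1, by simpa [add_assoc, add_comm 1] using hab.2⟩
    exact hchain M le_rfl

theorem exists_forall_mem_connectedComponentIn_cylinder [CompactSpace (LimitSpace π φ)]
    (hc : 0 ≤ c) (hc1 : c < 1) (hA : 0 ≤ A) (hcyl : ∀ n x y, L n x y → y ∈ cylinder A c n x)
    (hrefine : ∀ n x y, L n x y → Steps (L (n + 1)) M x y) :
    ∃ B ≥ 0, ∀ n x y, L n x y → y ∈ connectedComponentIn (cylinder B c n x) x := by
  have := metrizableSpace π φ
  let m := TopologicalSpace.metrizableSpaceMetric (LimitSpace π φ)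
  have hc1' : 0 < 1 - c := sub_pos.2 hc1
  obtain ⟨B, hB⟩ : ∃ B, B * (1 - c) = M * A + A := ⟨_, div_mul_cancel₀ _ hc1'.ne'⟩
  have hMA : 0 ≤ M * A := by positivity
  have hAB : A ≤ B := by nlinarith
  have hB0 : 0 ≤ B := hA.trans hAB
  refine ⟨B, hB0, fun n x y h => ?_⟩
  refine mem_connectedComponentIn_of_chains isClosed_cylinder.isCompact (mem_cylinder_self hc hB0)
    fun δ hδ => ?_
  obtain ⟨k, hk⟩ := eventually_atTop.1
    (eventually_forall_cylinder_dist_lt hc hc1 hA (m := m) rfl hδ)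
  refine Relation.ReflTransGen.mono (fun a b hab => ?_) _ _
    (reflTransGen_of_refines hc hA hAB (by nlinarith) hcyl hrefine k h)
  exact ⟨hab.1, hk (n + k) (Nat.le_add_left k n) a b (hcyl _ a b hab.2)⟩

end Refinement

section Linked

theorem shift_iterate_coord {X₀ X₁ : Type*} {π φ : X₁ → X₀} (x : LimitSpace π φ) (n i : ℕ) :
    ((shift π φ)^[n] x).1 i = x.1 (i + n) := by
  induction n generalizing x with
  | zero => rfl
  | succ n ih =>
    rw [Function.iterate_succ_apply, ih]
    rfl

/-- Two points of the limit space are linked at time `n` if their initial segments of length `n`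
are joined by a chain of at most `N` partial orbits, which need not come from points of the limit
space. -/
def Linked {X₀ X₁ : Type*} [MetricSpace X₁] {π φ : X₁ → X₀} (r : ℝ) (N n : ℕ)
    (x y : LimitSpace π φ) : Prop :=
  Steps (OrbitStep π φ r n) N x.1 y.1

variable {X₀ X₁ : Type*} [MetricSpace X₁] {π φ : X₁ → X₀} {c ρ r : ℝ} {M N n : ℕ}
  {x y : LimitSpace π φ}

theorem Linked.mono (h : Linked r M n x y) (hr : 0 ≤ r) (hMN : M ≤ N) : Linked r N n x y :=
  Steps.mono ((y.isPartialOrbit n).orbitStep_self hr) hMN h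

variable [MetricSpace X₀]

theorem Linked.mem_cylinder (hπ : HasIsometricSheets π ρ) (hφ : IsBackwardContracting c φ)
    (hr : r < ρ) (h : Linked r N n x y) : y ∈ cylinder (N * r) c n x :=
  fun _ hi => h.dist_le_mul_pow hπ hφ hr hi

theorem exists_steps_shift_iterate_eq (hπ : HasIsometricSheets π ρ)
    (hφ : IsBackwardContracting c φ) (hr : r < ρ)
    (hN : ∀ a b : X₁, Steps (fun a b => dist a b ≤ r) (N + 1) a b) {z : ℕ → X₁}
    (hz : IsPartialOrbit π φ n z) (u : LimitSpace π φ) :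
    ∃ w : LimitSpace π φ, Steps (OrbitStep π φ r n) (N + 1) z w.1 ∧ (shift π φ)^[n] w = u := by
  obtain ⟨w, hzw, hwu⟩ := hz.exists_steps (v := fun i => u.1 (i - n)) hπ hφ hr (hN _ _)
  have hw : ∀ i, π (w i) = φ (w (i + 1)) := fun i => by
    rcases lt_or_ge i n with hi | hi
    · exact hzw.isPartialOrbit_right hz i hi
    · rw [hwu i hi, hwu (i + 1) (hi.trans i.le_succ), Nat.sub_add_comm hi]
      exact u.2 (i - n)
  exact ⟨⟨w, hw⟩, hzw, ext_coord fun i => (shift_iterate_coord ⟨w, hw⟩ n i).trans <| by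
    simpa using hwu (i + n) (Nat.le_add_left n i)⟩

theorem steps_linked_of_steps (hπ : HasIsometricSheets π ρ) (hφ : IsBackwardContracting c φ)
    (hr0 : 0 ≤ r) (hr : r < ρ) (hN : ∀ a b : X₁, Steps (fun a b => dist a b ≤ r) (N + 1) a b)
    {z : ℕ → X₁} (hxz : Steps (OrbitStep π φ r n) M x.1 z)
    (hzy : Steps (OrbitStep π φ r n) (N + 1) z y.1) :
    Steps (Linked r (N + 1 + 1 + (N + 1)) n) (M + 1) x y := by
  obtain ⟨ζ, hζ0, rfl, hζ⟩ := hxz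
  induction M generalizing y with
  | zero =>
    rw [hζ0] at hzy
    exact .single (Linked.mono hzy hr0 (by omega))
  | succ M ih =>
    have hstep := hζ M M.lt_succ_self
    obtain ⟨w, hw, -⟩ := exists_steps_shift_iterate_eq hπ hφ hr hN hstep.left x
    have hwy : Linked r (N + 1 + 1 + (N + 1)) n w y :=
      ((hw.symm fun _ _ h => h.symm).trans (.single hstep)).trans hzy
    exact (ih (fun j hj => hζ j (hj.trans M.lt_succ_self)) hw).trans (.single hwy)

end Linked

section Connected

variable {X₀ X₁ : Type*} [MetricSpace X₀] [MetricSpace X₁] [CompactSpace X₁]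
  [PathConnectedSpace X₁] {π φ : C(X₁, X₀)} {c ρ r : ℝ} {N : ℕ}

theorem exists_forall_mem_connectedComponentIn_of_linked (hπ : IsCoveringMap π)
    (hρ : HasIsometricSheets π ρ) (hφ : IsBackwardContracting c φ) (hr : IsFillingScale X₁ ρ r)
    (hrec : ∀ x, Function.Surjective (FundamentalGroup.map φ x))
    (hN : ∀ a b : X₁, Steps (fun a b => dist a b ≤ r) (N + 1) a b) :
    ∃ B ≥ 0, ∀ n, ∀ x y : LimitSpace π φ, Linked r (N + 1 + 1 + (N + 1)) n x y →
      y ∈ connectedComponentIn (cylinder B c n x) x := by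
  have hr0 : 0 ≤ r := hr.pos.le
  have := compactSpace π.continuous φ.continuous
  obtain ⟨M, hM⟩ := exists_forall_steps_succ hπ hρ hφ hr hrec (N + 1 + 1 + (N + 1))
  refine exists_forall_mem_connectedComponentIn_cylinder hφ.1.le hφ.2.1 (by positivity)
    (fun n x y h => h.mem_cylinder hρ hφ hr.lt)
    fun n x y h => steps_linked_of_steps hρ hφ hr0 hr.lt hN
      (hM n x.1 y.1 (x.isPartialOrbit _) (y.isPartialOrbit _) h) ?_
  exact .mono ((y.isPartialOrbit _).orbitStep_self hr0) (Nat.zero_le _) (.zero _)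

theorem connectedSpace_and_locallyConnectedSpace [LocallyPathConnectedSpace X₁]
    (hπ : IsCoveringMap π) (hsurj : Function.Surjective π) (hρ : HasIsometricSheets π ρ)
    (hφ : IsBackwardContracting c φ)
    (hrec : ∀ x, Function.Surjective (FundamentalGroup.map φ x)) :
    ConnectedSpace (LimitSpace π φ) ∧ LocallyConnectedSpace (LimitSpace π φ) := by
  have := compactSpace π.continuous φ.continuous
  obtain ⟨r, hr⟩ := IsFillingScale.exists_of_pos (X := X₁) hρ.pos
  have hr0 : 0 ≤ r := hr.pos.le
  obtain ⟨N, hN'⟩ := exists_forall_steps_dist_le (X := X₁) hr.pos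
  have hN : ∀ a b : X₁, Steps (fun a b => dist a b ≤ r) (N + 1) a b := fun a b =>
    (hN' a b).mono (by simpa using hr0) N.le_succ
  obtain ⟨B, hB, hcomp⟩ :=
    exists_forall_mem_connectedComponentIn_of_linked hπ hρ hφ hr hrec hN
  constructor
  · refine { toPreconnectedSpace := ⟨isPreconnected_of_forall_pair fun x _ y _ => ?_⟩,
             toNonempty := nonempty π.continuous φ.continuous hsurj }
    obtain ⟨w, hxw, hwy⟩ := exists_steps_shift_iterate_eq hρ hφ hr.lt hN (x.isPartialOrbit 0) y
    obtain rfl : w = y := hwy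
    have hlink : Linked r (N + 1 + 1 + (N + 1)) 0 x w := Linked.mono hxw hr0 (by omega)
    exact ⟨_, subset_univ _, mem_connectedComponentIn (mem_cylinder_self hφ.1.le hB),
      hcomp 0 x w hlink, isPreconnected_connectedComponentIn⟩
  · refine locallyConnectedSpace_iff_connected_subsets.2 fun x U hU => ?_
    obtain ⟨n, hn⟩ := exists_cylinder_subset hφ.1.le hφ.2.1 hB hU
    refine ⟨connectedComponentIn (cylinder B c n x) x, ?_, isPreconnected_connectedComponentIn,
      (connectedComponentIn_subset _ _).trans hn⟩
    filter_upwards [mem_nhds_of_coords x n hr.pos] with y hy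
    have hlink : Linked r 1 n x y :=
      .single ⟨x.isPartialOrbit n, y.isPartialOrbit n, fun i hi => (hy i hi).le⟩
    exact hcomp n x y (hlink.mono hr0 (by omega))

end Connected

section Covering

variable {X₀ X₁ : Type*} {π φ : X₁ → X₀}

/-- The preimage of `z` under the shift with first term `b`. -/
def cons (b : X₁) (z : LimitSpace π φ) (h : π b = φ (z.1 0)) : LimitSpace π φ :=
  ⟨fun i => Nat.casesOn i b z.1, fun i => Nat.casesOn i h z.2⟩

theorem encard_shift_fiber (z : LimitSpace π φ) :
    (shift π φ ⁻¹' {z}).encard = (π ⁻¹' {φ (z.1 0)}).encard := by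
  have hinj : InjOn (fun x : LimitSpace π φ => x.1 0) (shift π φ ⁻¹' {z}) :=
    fun x hx y hy h0 => ext_coord fun i => by
      cases i with
      | zero => exact h0
      | succ i => exact congrArg (fun w : LimitSpace π φ => w.1 i) (hx.trans hy.symm)
  rw [← hinj.encard_image]
  congr 1
  ext b
  constructor
  · rintro ⟨x, rfl, rfl⟩
    exact x.2 0
  · intro hb
    exact ⟨cons b z hb, rfl, rfl⟩

theorem continuous_shift [TopologicalSpace X₁] (π φ : X₁ → X₀) : Continuous (shift π φ) :=
  continuous_induced_rng.2 (continuous_pi fun i => continuous_coord (i + 1))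

variable [MetricSpace X₀] [MetricSpace X₁] {c ρ : ℝ} {x y : LimitSpace π φ}

theorem eq_of_shift_iterate_eq (hπ : HasIsometricSheets π ρ) (hφ : IsBackwardContracting c φ)
    {k : ℕ} (h : ∀ i < k, dist (x.1 i) (y.1 i) < ρ)
    (hxy : (shift π φ)^[k] x = (shift π φ)^[k] y) : x = y := by
  have htail : ∀ i, k ≤ i → x.1 i = y.1 i := fun i hi => by
    simpa only [shift_iterate_coord, Nat.sub_add_cancel hi] using
      congrArg (fun w : LimitSpace π φ => w.1 (i - k)) hxy
  have hclose : ∀ i ≤ k, dist (x.1 i) (y.1 i) < ρ := fun i hi => by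
    rcases hi.lt_or_eq with hi | rfl
    · exact h i hi
    · simpa [htail i le_rfl] using hπ.pos
  refine ext_coord fun i => ?_
  rcases le_total i k with hi | hi
  · exact (x.isPartialOrbit k).eq_of_dist_lt hπ hφ (y.isPartialOrbit k) hclose (htail k le_rfl) hi
  · exact htail i hi

theorem eq_of_forall_dist_lt (hπ : HasIsometricSheets π ρ) (hφ : IsBackwardContracting c φ)
    (h : ∀ i, dist (x.1 i) (y.1 i) < ρ) : x = y := by
  refine ext_coord fun i => dist_le_zero.1 ?_
  have hlim : Tendsto (fun k => c ^ k * ρ) atTop (𝓝 0) := by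
    simpa using (tendsto_pow_atTop_nhds_zero_of_lt_one hφ.1.le hφ.2.1).mul_const ρ
  refine ge_of_tendsto' hlim fun k => ?_
  calc dist (x.1 i) (y.1 i) ≤ c ^ (i + k - i) * dist (x.1 (i + k)) (y.1 (i + k)) :=
        (x.isPartialOrbit _).dist_le_pow_mul hπ hφ (y.isPartialOrbit _) (fun j _ => h j)
          (Nat.le_add_right i k)
    _ ≤ c ^ k * ρ := by
        rw [Nat.add_sub_cancel_left]
        exact mul_le_mul_of_nonneg_left (h _).le (pow_nonneg hφ.1.le k)

variable [CompactSpace (LimitSpace π φ)]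

theorem isOpenMap_shift (hπ : HasIsometricSheets π ρ) (hφ : IsBackwardContracting c φ) :
    IsOpenMap (shift π φ) := by
  refine IsOpenMap.of_nhds_le fun x U hU => ?_
  obtain ⟨n, hn⟩ := exists_cylinder_subset hφ.1.le hφ.2.1 hπ.pos.le (mem_map.1 hU)
  have hδ : 0 < ρ * c ^ n := mul_pos hπ.pos (pow_pos hφ.1 n)
  filter_upwards [mem_nhds_of_coords (shift π φ x) n hδ] with z hz
  have hlt : dist (π (x.1 0)) (φ (z.1 0)) < ρ * c ^ n := by
    rw [x.2 0]
    exact ((hφ.2.2 _ _).trans (mul_le_of_le_one_left dist_nonneg hφ.2.1.le)).trans_lt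
      (hz 0 n.zero_le)
  obtain ⟨b, hb, hxb⟩ := hπ.exists_lift _ _
    (hlt.trans_le (mul_le_of_le_one_right hπ.pos.le (pow_le_one₀ hφ.1.le hφ.2.1.le)))
  refine hn (show cons b z hb ∈ cylinder ρ c n x from fun i hi => ?_)
  have hclose : dist (x.1 i) ((cons b z hb).1 i) ≤ ρ * c ^ n := by
    cases i with
    | zero => exact (hxb.trans_lt hlt).le
    | succ i => exact (hz i (Nat.le_of_succ_le hi)).le
  exact hclose.trans (mul_le_mul_of_nonneg_left
    (pow_le_pow_of_le_one hφ.1.le hφ.2.1.le (Nat.sub_le n i)) hπ.pos.le)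

theorem isCoveringMap_shift (hπ : HasIsometricSheets π ρ) (hφ : IsBackwardContracting c φ) :
    IsCoveringMap (shift π φ) := by
  have := metrizableSpace π φ
  rw [← isLocalHomeomorph_iff_isCoveringMap, isLocalHomeomorph_iff_isOpenEmbedding_restrict]
  intro x
  have hU : IsOpen {y : LimitSpace π φ | dist (y.1 0) (x.1 0) < ρ / 2} :=
    isOpen_lt ((continuous_coord 0).dist continuous_const) continuous_const
  refine ⟨_, hU.mem_nhds (by simpa using hπ.pos), ?_⟩
  refine .of_continuous_injective_isOpenMap ((continuous_shift π φ).comp continuous_subtype_val)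
    ?_ ((isOpenMap_shift hπ hφ).comp hU.isOpenMap_subtype_val)
  rintro ⟨y, hy⟩ ⟨z, hz⟩ hyz
  refine Subtype.ext (eq_of_shift_iterate_eq hπ hφ (k := 1) (fun i hi => ?_) hyz)
  obtain rfl := Nat.lt_one_iff.1 hi
  exact (dist_triangle_right _ _ (x.1 0)).trans_lt ((add_lt_add hy hz).trans_eq (add_halves ρ))

theorem separatesOrbits_shift (hπ : HasIsometricSheets π ρ) (hφ : IsBackwardContracting c φ)
    {m : MetricSpace (LimitSpace π φ)} (hm : IsCompatibleMetric m) :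
    SeparatesOrbits m (shift π φ) := by
  obtain ⟨e, he, h⟩ := hm.exists_pos_forall_dist_lt (continuous_coord (π := π) (φ := φ) 0) hπ.pos
  refine ⟨e, he, fun x y hxy => ?_⟩
  by_contra! hle
  refine hxy (eq_of_forall_dist_lt hπ hφ fun i => ?_)
  simpa only [shift_iterate_coord, Nat.zero_add] using h _ _ (hle i)

theorem axiomIrreducibility_shift {r : ℝ} (hπ : HasIsometricSheets π ρ)
    (hφ : IsBackwardContracting c φ) (hr0 : 0 ≤ r) (hr : r < ρ) {N : ℕ}
    (hN : ∀ a b : X₁, Steps (fun a b => dist a b ≤ r) (N + 1) a b) :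
    AxiomIrreducibility (shift π φ) := by
  rintro W hW ⟨x, hx⟩
  obtain ⟨n, hn⟩ := exists_cylinder_subset hφ.1.le hφ.2.1 (B := (N + 1 : ℕ) * r) (by positivity)
    (hW.mem_nhds hx)
  refine ⟨n, eq_univ_of_forall fun u => ?_⟩
  obtain ⟨w, hxw, rfl⟩ := exists_steps_shift_iterate_eq hπ hφ hr hN (x.isPartialOrbit n) u
  exact ⟨w, hn (Linked.mem_cylinder hπ hφ hr hxw), rfl⟩

end Covering

end LimitSpace

section Pullback

variable {X : Type*} [TopologicalSpace X] {f : X → X} {𝒰 : Set (Set X)}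

theorem isPreconnected_of_mem_iteratedPullback (h𝒰 : ∀ U ∈ 𝒰, IsPreconnected U) {n : ℕ}
    {V : Set X} (hV : V ∈ iteratedPullback f 𝒰 n) : IsPreconnected V := by
  cases n with
  | zero => exact h𝒰 V hV
  | succ n =>
    rw [iteratedPullback, Function.iterate_succ_apply'] at hV
    obtain ⟨U, -, x, -, rfl⟩ := hV
    exact isPreconnected_connectedComponentIn

theorem exists_mapsTo_of_mem_iteratedPullback {n : ℕ} {V : Set X}
    (hV : V ∈ iteratedPullback f 𝒰 n) : ∃ U ∈ 𝒰, MapsTo f^[n] V U := by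
  induction n generalizing V with
  | zero => exact ⟨V, hV, mapsTo_id V⟩
  | succ n ih =>
    rw [iteratedPullback, Function.iterate_succ_apply'] at hV
    obtain ⟨U, hU, x, -, rfl⟩ := hV
    obtain ⟨U₀, hU₀, hmap⟩ := ih hU
    exact ⟨U₀, hU₀, hmap.comp (mapsTo_iff_subset_preimage.2 (connectedComponentIn_subset _ _))⟩

end Pullback

namespace LimitSpace

section Cover

variable {X₀ X₁ : Type*} [MetricSpace X₁] {π φ : X₁ → X₀} {c r : ℝ}
  {𝒰 : Set (Set (LimitSpace π φ))}

theorem exists_finite_cover [CompactSpace (LimitSpace π φ)] [LocallyConnectedSpace (LimitSpace π φ)]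
    (hr : 0 < r) : ∃ 𝒰 : Set (Set (LimitSpace π φ)), 𝒰.Finite ∧
      (∀ U ∈ 𝒰, IsOpen U ∧ IsConnected U) ∧ ⋃₀ 𝒰 = univ ∧
      ∀ U ∈ 𝒰, ∀ x ∈ U, ∀ y ∈ U, dist (x.1 0) (y.1 0) ≤ r := by
  have hball : ∀ x : LimitSpace π φ, ∃ U ∈ 𝓝 x, (IsOpen U ∧ IsConnected U) ∧
      ∀ y ∈ U, ∀ z ∈ U, dist (y.1 0) (z.1 0) ≤ r := by
    intro x
    obtain ⟨U, hU, hUo, hxU, hUc⟩ := locallyConnectedSpace_iff_subsets_isOpen_isConnected.1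
      inferInstance x _ (mem_nhds_of_coords x 0 (half_pos hr))
    refine ⟨U, hUo.mem_nhds hxU, ⟨hUo, hUc⟩, fun y hy z hz => ?_⟩
    linarith [dist_triangle_left (y.1 0) (z.1 0) (x.1 0), hU hy 0 le_rfl, hU hz 0 le_rfl]
  choose U hxU hU hsmall using hball
  obtain ⟨t, ht⟩ := CompactSpace.elim_nhds_subcover U hxU
  refine ⟨U '' t, t.finite_toSet.image U, forall_mem_image.2 fun x _ => hU x, ?_,
    forall_mem_image.2 fun x _ => hsmall x⟩
  rw [sUnion_image]
  exact ht

theorem axiomExpansion_shift [CompactSpace (LimitSpace π φ)] (hc : 0 ≤ c) (hc1 : c < 1)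
    (hr : 0 ≤ r) (h𝒰 : ∀ n, ∀ V ∈ iteratedPullback (shift π φ) 𝒰 n, ∀ x ∈ V, V ⊆ cylinder r c n x) :
    AxiomExpansion (shift π φ) 𝒰 := by
  refine ⟨metrizableSpace π φ, fun m hm => ENNReal.tendsto_nhds_zero.2 fun ε hε => ?_⟩
  obtain ⟨δ, hδ, hδε⟩ := ENNReal.lt_iff_exists_nnreal_btwn.1 hε
  filter_upwards [eventually_forall_cylinder_dist_lt hc hc1 hr hm
    (NNReal.coe_pos.2 (ENNReal.coe_pos.1 hδ))] with n hn
  refine iSup₂_le fun V hV => Metric.ediam_le fun x hx y hy => ?_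
  have hxy : edist x y < δ := edist_lt_coe.2 (hn x y (h𝒰 n V hV x hx hy))
  exact (hxy.trans hδε).le

variable [MetricSpace X₀] {ρ : ℝ}

theorem subset_cylinder_of_mem_iteratedPullback (hπ : HasIsometricSheets π ρ)
    (hφ : IsBackwardContracting c φ) (hr : r < ρ) (hconn : ∀ U ∈ 𝒰, IsPreconnected U)
    (hsmall : ∀ U ∈ 𝒰, ∀ x ∈ U, ∀ y ∈ U, dist (x.1 0) (y.1 0) ≤ r) {n : ℕ}
    {V : Set (LimitSpace π φ)} (hV : V ∈ iteratedPullback (shift π φ) 𝒰 n) {x : LimitSpace π φ}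
    (hx : x ∈ V) : V ⊆ cylinder r c n x := by
  obtain ⟨U, hU, hmap⟩ := exists_mapsTo_of_mem_iteratedPullback hV
  have hdist : ∀ y ∈ V, dist (x.1 n) (y.1 n) ≤ r := fun y hy => by
    simpa only [shift_iterate_coord, Nat.zero_add] using hsmall U hU _ (hmap hx) _ (hmap hy)
  have hpre : IsPreconnected ((fun y : LimitSpace π φ => y.1) '' V) :=
    (isPreconnected_of_mem_iteratedPullback hconn hV).image _ continuous_subtype_val.continuousOn
  exact fun y hy i hi => dist_le_mul_pow_of_isPreconnected hπ hφ hpre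
    (forall_mem_image.2 fun y _ => y.isPartialOrbit n) hr (mem_image_of_mem _ hx)
    (forall_mem_image.2 hdist) (mem_image_of_mem _ hy) hi

theorem axiomDegree_shift (hπ : HasIsometricSheets π ρ) (hφ : IsBackwardContracting c φ)
    (hr0 : 0 ≤ r) (hr : r < ρ)
    (h𝒰 : ∀ n, ∀ V ∈ iteratedPullback (shift π φ) 𝒰 n, ∀ x ∈ V, V ⊆ cylinder r c n x) :
    AxiomDegree (shift π φ) 𝒰 := by
  refine ⟨1, fun n k U _ V hV _ y _ => ?_⟩
  rw [Nat.cast_one, encard_le_one_iff]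
  rintro w w' ⟨hw, rfl⟩ ⟨hw', hww'⟩
  refine eq_of_shift_iterate_eq hπ hφ (fun i hi => ?_) (Eq.symm hww')
  calc dist (w.1 i) (w'.1 i) ≤ r * c ^ (n + k - i) :=
        h𝒰 (n + k) V hV w hw hw' i (hi.le.trans (Nat.le_add_left k n))
    _ ≤ r := mul_le_of_le_one_right hr0 (pow_le_one₀ hφ.1.le hφ.2.1.le)
    _ < ρ := hr

theorem exists_cover_axioms [CompactSpace X₁] [PreconnectedSpace X₁]
    [CompactSpace (LimitSpace π φ)] [LocallyConnectedSpace (LimitSpace π φ)]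
    (hπ : HasIsometricSheets π ρ) (hφ : IsBackwardContracting c φ) :
    ∃ 𝒰 : Set (Set (LimitSpace π φ)), 𝒰.Finite ∧ (∀ U ∈ 𝒰, IsOpen U ∧ IsConnected U) ∧
      ⋃₀ 𝒰 = univ ∧ AxiomExpansion (shift π φ) 𝒰 ∧ AxiomDegree (shift π φ) 𝒰 ∧
      AxiomIrreducibility (shift π φ) := by
  have hr0 : 0 < ρ / 2 := half_pos hπ.pos
  have hr : ρ / 2 < ρ := half_lt_self hπ.pos
  obtain ⟨𝒰, hfin, hopen, hcover, hsmall⟩ := exists_finite_cover (π := π) (φ := φ) hr0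
  have hcyl : ∀ n, ∀ V ∈ iteratedPullback (shift π φ) 𝒰 n, ∀ x ∈ V, V ⊆ cylinder (ρ / 2) c n x :=
    fun n V hV x hx => subset_cylinder_of_mem_iteratedPullback hπ hφ hr
      (fun U hU => (hopen U hU).2.isPreconnected) hsmall hV hx
  obtain ⟨N, hN⟩ := exists_forall_steps_dist_le (X := X₁) hr0
  exact ⟨𝒰, hfin, hopen, hcover, axiomExpansion_shift hφ.1.le hφ.2.1 hr0.le hcyl,
    axiomDegree_shift hπ hφ hr0.le hr hcyl, axiomIrreducibility_shift hπ hφ hr0.le hr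
      fun a b => (hN a b).mono (by simpa using hr0.le) N.le_succ⟩

end Cover

end LimitSpace

theorem IsCoveringMapOfDegree.surjective {X Y : Type*} [TopologicalSpace X] [TopologicalSpace Y]
    [Nonempty X] {p : X → Y} {d : ℕ} (hp : IsCoveringMapOfDegree p d) : Function.Surjective p := by
  intro y
  obtain ⟨x⟩ := ‹Nonempty X›
  have hne : (p ⁻¹' {y}).encard ≠ 0 := by
    rw [hp.2 y, ← hp.2 (p x), encard_ne_zero]
    exact ⟨x, rfl⟩
  exact encard_ne_zero.1 hne

theorem theorem2p1_general {X₀ X₁ : Type*} [MetricSpace X₀] [MetricSpace X₁] [CompactSpace X₁]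
    [LocallyPathConnectedSpace X₁] (π φ : C(X₁, X₀)) (d : ℕ) (hπ : IsCoveringMapOfDegree π d)
    (hloc : IsLocalIsometry π) (c : ℝ) (hφ : IsBackwardContracting c φ) (hrec : IsRecurrent φ) :
    (ConnectedSpace (LimitSpace π φ) ∧ LocallyConnectedSpace (LimitSpace π φ)) ∧
    (IsPositivelyExpansive (LimitSpace.shift π φ) ∧
      IsCoveringMapOfDegree (LimitSpace.shift π φ) d) ∧
    IsTopologicallyCXC (LimitSpace.shift π φ) := by
  have : ConnectedSpace X₁ := hrec.connected_source
  have : PathConnectedSpace X₁ := pathConnectedSpace_iff_connectedSpace.2 this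
  obtain ⟨ρ, hρ⟩ := hloc.exists_hasIsometricSheets π.continuous hπ.1.isOpenMap
  have hcomp := LimitSpace.compactSpace π.continuous φ.continuous
  obtain ⟨hconn, hlc⟩ := LimitSpace.connectedSpace_and_locallyConnectedSpace hπ.1 hπ.surjective
    hρ hφ hrec.surjective_map
  have hcov : IsCoveringMapOfDegree (LimitSpace.shift π φ) d :=
    ⟨LimitSpace.isCoveringMap_shift hρ hφ, fun z => by rw [LimitSpace.encard_shift_fiber, hπ.2]⟩
  have hexp : IsPositivelyExpansive (LimitSpace.shift π φ) :=
    ⟨LimitSpace.metrizableSpace π φ, LimitSpace.continuous_shift π φ, hcov.surjective,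
      fun _ => LimitSpace.separatesOrbits_shift hρ hφ⟩
  exact ⟨⟨hconn, hlc⟩, ⟨hexp, hcov⟩, hcomp, hconn, hlc, hcov.1,
    LimitSpace.exists_cover_axioms hρ hφ⟩

theorem theorem2p1 {X₀ X₁ : Type*} [MetricSpace X₀] [MetricSpace X₁]
    [CompleteSpace X₀] [CompleteSpace X₁]
    [CWComplex (univ : Set X₀)] [CWComplex.Finite (univ : Set X₀)]
    [CWComplex (univ : Set X₁)] [CWComplex.Finite (univ : Set X₁)]
    (hX₀ : IsLengthMetric X₀) (hX₁ : IsLengthMetric X₁)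
    (π φ : C(X₁, X₀)) (d : ℕ) (hπ : IsCoveringMapOfDegree π d)
    (hloc : IsLocalIsometry π)
    (c : ℝ) (hφ : IsBackwardContracting c φ) (hrec : IsRecurrent φ) :
    (ConnectedSpace (LimitSpace π φ) ∧ LocallyConnectedSpace (LimitSpace π φ)) ∧
    (IsPositivelyExpansive (LimitSpace.shift π φ) ∧
      IsCoveringMapOfDegree (LimitSpace.shift π φ) d) ∧
    IsTopologicallyCXC (LimitSpace.shift π φ) := by
  have : CompactSpace X₁ := compactSpace_of_finite_cwComplex
  have : LocallyPathConnectedSpace X₁ := hX₁.locallyPathConnectedSpace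
  exact theorem2p1_general π φ d hπ hloc c hφ hrec
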